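/- **Setting.** Let $d\in\{1,2,3\}$, and let either (Neumann case) $\Omega\subset\mathbb R^d$ be a bounded domain with $C^2$ boundary, or (periodic case) $\Omega=(0,L)^d$ with $L>0$. Let $\dot H^1$ be $H^1(\Omega)$ in the Neumann case and the space of $L$-periodic $H^1$ functions in the periodic case. Let $A=-\Delta$ on $L^2(\Omega)$ with domain $\mathcal D(A)=\{v\in H^2(\Omega):\partial_\nu v=0\text{ on }\partial\Omega\}$ in the Neumann case, and the $L$-periodic $H^2$ functions in the periodic case. Write $\|\cdot\|$ for the norm and $(\cdot,\cdot)$ for the inner product of $L^2(\Omega)$, $m(v)=|\Omega|^{-1}\int_\Omega v\,dx$, $\bar v=v-m(v)$, $|v|_1=\|\nabla v\|$, and, for $v\in L^2(\Omega)$ with $m(v)=0$, $$|v|_{-1}=\sup\{|(v,\chi)|/|\chi|_1:\ \chi\in\dot H^1,\ |\chi|_1\neq0\}.$$ Let $\varepsilon>0$, $c_0>0$, $c_1,c_3\in\mathbb R$, $c_2:(0,\infty)\to\mathbb R$, and $2\le p<\infty$, with $p=2$ if $d=3$. Let $F:\mathbb R\to\mathbb R$ be differentiable with $F'=f$, $F(0)=0$,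 and, for all $v\in\mathbb R$ and $\eta>0$ (where $v^{2p}$ means $|v|^{2p}$), $$f(v)v\ge pc_0v^{2p}-c_1,\qquad |f(v)|\le\eta c_0v^{2p}+c_2(\eta),\qquad \tfrac12c_0v^{2p}-c_3\le F(v)\le\tfrac32c_0v^{2p}+c_3 .$$ For $\alpha\ge0$ put $C_1(\alpha)=(c_1+c_2\alpha+2c_3)|\Omega|$, where $c_2=c_2\big((p-\tfrac32)/\alpha\big)$ and the term $c_2\alpha$ is $0$ for $\alpha=0$. A *mesh* is a sequence $0=t^0<t^1<\cdots$ with $t^n\to\infty$ whose steps $k_n=t^{n+1}-t^n$ have a finite supremum $k=\sup_nk_n$. A *solution of the implicit Euler scheme* on it, starting from $u_0\in L^2(\Omega)$, is a sequence with $u^0=u_0$ and $u^{n+1}\in\mathcal D(A)$ such that, for all $n\ge0$, $$\frac{u^{n+1}-u^n}{k_n}+Aw^{n+1}=0,\qquad w^{n+1}=\varepsilon Au^{n+1}+f(u^{n+1})\in\mathcal D(A).$$ **Lemma (stability estimate in $H^{-1}$).** There is a constant $\gamma_1>0$, depending only on $\Omega$ and the type of boundary condition, with $|\bar v|_{-1}\le\gamma_1|v|_1$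 for all $v\in\dot H^1$. For every such $\gamma_1$, all data as above, all $\alpha\ge0$ and all $k>0$, the following holds. 1. For every mesh with $\sup_nk_n=k$ and every solution of the scheme with $|m(u_0)|\le\alpha$, the number $|\overline{u_0}|_{-1}$ is finite and, for all $n\ge0$, $$|\overline{u^{n+1}}|_{-1}^2\le e^{-\varepsilon t^{n+1}/(\gamma_1^2+\varepsilon k)}\,|\overline{u_0}|_{-1}^2+2C_1(\alpha)\,\frac{\gamma_1^2+\varepsilon k}{\varepsilon}\Big(1-e^{-\varepsilon t^{n+1}/(\gamma_1^2+\varepsilon k)}\Big).$$ 2. Let $\rho_{0k}=\big(2C_1(\alpha)(\gamma_1^2+\varepsilon k)/\varepsilon\big)^{1/2}$, $\rho>\rho_{0k}$ and $R\ge0$. There is a time $T=T(R,\alpha,\rho,k)$, which does not depend on the mesh or on $u_0$, such that every mesh with $\sup_nk_n=k$ has a positive integer $n_{0k}$, at most the first positive index $i$ with $t^i\ge T$, for which every solution with $|m(u_0)|\le\alpha$ and $|\overline{u_0}|_{-1}\le R$ satisfies $|\overline{u^n}|_{-1}\le\rho$ for all $n\ge n_{0k}$. -/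

import Mathlib

open MeasureTheory Filter Topology
open scoped ContDiff

noncomputable section

namespace CahnHilliard

/-- The Euclidean space `ℝ^d`. -/
abbrev E (d : ℕ) : Type := EuclideanSpace ℝ (Fin d)

/-- The two boundary conditions: homogeneous Neumann (flux) conditions, and periodicity with
period `L` in every coordinate direction. -/
inductive BoundaryCondition : Type
  | neumann : BoundaryCondition
  | periodic (L : ℝ) : BoundaryCondition

variable {d : ℕ}

/-- The boundary of `Ω` is of class `C²` and `Ω` lies locally on one side of it: near every
boundary point, `Ω` is the sublevel set `{r < 0}` of a `C²` function with nonzero differential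
at that point. -/
def HasC2Boundary (Ω : Set (E d)) : Prop :=
  ∀ x ∈ frontier Ω, ∃ U ∈ 𝓝 x, ∃ r : E d → ℝ,
    ContDiff ℝ 2 r ∧ fderiv ℝ r x ≠ 0 ∧ Ω ∩ U = {y | r y < 0} ∩ U

/-- The domains that go with a boundary condition: bounded domains with `C²` boundary in the
Neumann case, the cube `(0, L)^d` in the periodic case. -/
def BoundaryCondition.IsDomain : BoundaryCondition → Set (E d) → Prop
  | .neumann, Ω => IsOpen Ω ∧ IsConnected Ω ∧ Bornology.IsBounded Ω ∧ HasC2Boundary Ω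
  | .periodic L, Ω => 0 < L ∧ Ω = {x | ∀ i, 0 < x i ∧ x i < L}

/-- `v ∈ H¹(Ω)` with weak gradient `G`. -/
structure IsWeakGradient (Ω : Set (E d)) (v : E d → ℝ) (G : E d → E d) : Prop where
  memLp : MemLp v 2 (volume.restrict Ω)
  memLp_grad : MemLp G 2 (volume.restrict Ω)
  integral_eq : ∀ φ : E d → ℝ, ContDiff ℝ ∞ φ → HasCompactSupport φ → tsupport φ ⊆ Ω → ∀ i,
    ∫ x in Ω, v x * fderiv ℝ φ x (EuclideanSpace.single i 1) = -∫ x in Ω, G x i * φ x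

/-- `v` lies in the space `Ḣ¹ = D(A^{1/2})` of the boundary condition and `∇v = G`. In the Neumann
case the space is `H¹(Ω)`. In the periodic case it is the subspace of periodic functions: no
boundary term appears when integrating by parts against a smooth periodic function. -/
def BoundaryCondition.HasGradient :
    BoundaryCondition → Set (E d) → (E d → ℝ) → (E d → E d) → Prop
  | .neumann, Ω, v, G => IsWeakGradient Ω v G
  | .periodic L, Ω, v, G => IsWeakGradient Ω v G ∧
      ∀ φ : E d → ℝ, ContDiff ℝ ∞ φ →
        (∀ x i, φ (x + L • EuclideanSpace.single i 1) = φ x) → ∀ i,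
          ∫ x in Ω, v x * fderiv ℝ φ x (EuclideanSpace.single i 1) = -∫ x in Ω, G x i * φ x

/-- `v ∈ D(A)` and `A v = g`, where `A = -Δ` under the boundary condition: `v ∈ H²(Ω) ∩ Ḣ¹`,
`g = -Δ v`, and Green's formula against elements of `Ḣ¹` has no boundary term. The latter says
that the normal derivative vanishes on the boundary in the Neumann case, and that it is periodic
in the periodic case. -/
def BoundaryCondition.IsNegLaplacian (bc : BoundaryCondition) (Ω : Set (E d))
    (v g : E d → ℝ) : Prop :=
  ∃ (G : E d → E d) (H : Fin d → E d → E d),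
    bc.HasGradient Ω v G ∧
    (∀ i, IsWeakGradient Ω (fun x => G x i) (H i)) ∧
    (g =ᵐ[volume.restrict Ω] fun x => -∑ i, H i x i) ∧
    ∀ (φ : E d → ℝ) (Φ : E d → E d), bc.HasGradient Ω φ Φ →
      ∫ x in Ω, inner ℝ (G x) (Φ x) = ∫ x in Ω, g x * φ x

/-- The dual norm `|v|₋₁ = sup { |(v, χ)| / |χ|₁ : χ ∈ Ḣ¹ }`, where `|χ|₁ = ‖∇χ‖`, with values
in `[0, ∞]`. Here `0 / 0 = 0` and `a / 0 = ∞` for `a ≠ 0`, so constants `χ` contribute nothing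
if `v` has mean zero. -/
def BoundaryCondition.negNorm (bc : BoundaryCondition) (Ω : Set (E d)) (v : E d → ℝ) : ENNReal :=
  ⨆ (χ : E d → ℝ) (X : E d → E d) (_ : bc.HasGradient Ω χ X),
    ENNReal.ofReal |∫ x in Ω, v x * χ x| / eLpNorm X 2 (volume.restrict Ω)

/-- The average `m(v)` over `Ω`. -/
def mean (Ω : Set (E d)) (v : E d → ℝ) : ℝ := (∫ x in Ω, v x) / volume.real Ω

/-- `v - m(v)`. -/
def fluct (Ω : Set (E d)) (v : E d → ℝ) : E d → ℝ := fun x => v x - mean Ω v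

/-- `γ₁` is a positive constant with `|v - m(v)|₋₁ ≤ γ₁ |v|₁` for all `v`. -/
def BoundaryCondition.IsGamma (bc : BoundaryCondition) (Ω : Set (E d)) (γ₁ : ℝ) : Prop :=
  0 < γ₁ ∧ ∀ (v : E d → ℝ) (G : E d → E d), bc.HasGradient Ω v G →
    bc.negNorm Ω (fluct Ω v) ≤ ENNReal.ofReal γ₁ * eLpNorm G 2 (volume.restrict Ω)

/-- The structural assumptions on `f` and its primitive `F`, with exponent `p` and constants
`c₀, c₁, c₂(η), c₃`; `v^{2p}` means `|v|^{2p}`. -/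
structure Nonlinearity (d : ℕ) (f F : ℝ → ℝ) (p c₀ c₁ : ℝ) (c₂ : ℝ → ℝ) (c₃ : ℝ) : Prop where
  two_le : 2 ≤ p
  eq_two : d = 3 → p = 2
  c₀_pos : 0 < c₀
  coercive : ∀ v, p * c₀ * |v| ^ (2 * p) - c₁ ≤ f v * v
  growth : ∀ η, 0 < η → ∀ v, |f v| ≤ η * c₀ * |v| ^ (2 * p) + c₂ η
  primitive : ∀ v, HasDerivAt F (f v) v
  primitive_zero : F 0 = 0
  lower : ∀ v, 1 / 2 * c₀ * |v| ^ (2 * p) - c₃ ≤ F v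
  upper : ∀ v, F v ≤ 3 / 2 * c₀ * |v| ^ (2 * p) + c₃

/-- `C₁(α) = (c₁ + c₂ α + 2 c₃) |Ω|`, where `c₂ = c₂(η)` with `η = (p - 3/2) / α`. For `α = 0`
the middle term is zero. -/
def C1 (Ω : Set (E d)) (p c₁ : ℝ) (c₂ : ℝ → ℝ) (c₃ α : ℝ) : ℝ :=
  (c₁ + c₂ ((p - 3 / 2) / α) * α + 2 * c₃) * volume.real Ω

/-- `0 = t⁰ < t¹ < ⋯` is a partition of `[0, ∞)` whose steps have supremum `k`. -/
structure IsMesh (t : ℕ → ℝ) (k : ℝ) : Prop where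
  zero : t 0 = 0
  strictMono : StrictMono t
  tendsto : Tendsto t atTop atTop
  isLUB : IsLUB (Set.range fun n => t (n + 1) - t n) k

/-- `u⁰, u¹, …` solves the implicit Euler scheme on the mesh `t`: `u⁰ ∈ L²(Ω)` and, for all `n`,
`(uⁿ⁺¹ - uⁿ) / kₙ + A w = 0` with `w = ε A uⁿ⁺¹ + f(uⁿ⁺¹)`, where `uⁿ⁺¹, w ∈ D(A)`. -/
def BoundaryCondition.IsEulerSolution (bc : BoundaryCondition) (Ω : Set (E d)) (ε : ℝ)
    (f : ℝ → ℝ) (t : ℕ → ℝ) (u : ℕ → E d → ℝ) : Prop :=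
  MemLp (u 0) 2 (volume.restrict Ω) ∧
  ∀ n, ∃ Au w Aw : E d → ℝ,
    bc.IsNegLaplacian Ω (u (n + 1)) Au ∧
    (w =ᵐ[volume.restrict Ω] fun x => ε * Au x + f (u (n + 1) x)) ∧
    bc.IsNegLaplacian Ω w Aw ∧
    ∀ᵐ x ∂(volume.restrict Ω), (u (n + 1) x - u n x) / (t (n + 1) - t n) + Aw x = 0

end CahnHilliard

end

open MeasureTheory Filter Topology
open scoped ContDiff

noncomputable section

namespace CahnHilliard

variable {d : ℕ}

/-! The estimate is the discrete energy argument with `A⁻¹(uⁿ⁺¹ - m(uⁿ⁺¹))` as test function. For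
mean-zero `g` in L², the functional `χ ↦ (g, χ)` is bounded by a multiple of `‖∇χ‖`, so it has a
Riesz representative `Z` in the closure of the space of gradients, and the dual norm of `g` is
exactly `‖Z‖` (`exists_represents`, `Represents.negNorm_eq`). Thus `Z` plays the role of `∇A⁻¹g`,
and `A⁻¹` itself is never constructed.

In these terms a step of the scheme reads `Z' = Z - κ∇w`, hence `‖Z'‖² + 2κ(Z', ∇w) ≤ ‖Z‖²`. Here
`(Z', ∇w)` is the pairing of `w` with the fluctuation of `u'`: the linear part of `w` gives
`ε‖∇u'‖²`, and the part with `f` is at least `-C₁(α)` because the mean is conserved (`neg_C1_le`).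
The definition of `γ₁` turns `‖∇u'‖²` into `‖Z'‖²` (`exists_represents_step`), and a discrete
Gronwall argument closes the estimate (`discrete_gronwall_step`). The absorbing ball follows by
letting the time in the exponential tend to infinity.

The boundedness of the functional, and the existence of `γ₁`, rest on the Poincaré–Wirtinger
inequality. It is proved by translations: local inequalities on balls inside the domain are carried
to the boundary by a shift and glued along overlaps, using connectedness
(`IsLocallyShiftable.poincareOn`). -/

/-! ### L² duality and translates of Sobolev functions -/

theorem abs_integral_inner_le {X V : Type*} [MeasurableSpace X] {μ : Measure X}
    [NormedAddCommGroup V] [InnerProductSpace ℝ V] {f g : X → V}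
    (hf : MemLp f 2 μ) (hg : MemLp g 2 μ) :
    |∫ x, inner ℝ (f x) (g x) ∂μ| ≤ (eLpNorm f 2 μ).toReal * (eLpNorm g 2 μ).toReal := by
  have h := abs_real_inner_le_norm (hf.toLp f) (hg.toLp g)
  rw [L2.inner_def, Lp.norm_toLp, Lp.norm_toLp] at h
  convert h using 2
  apply integral_congr_ae
  filter_upwards [hf.coeFn_toLp, hg.coeFn_toLp] with x h1 h2
  rw [h1, h2]

theorem abs_integral_mul_le {X : Type*} [MeasurableSpace X] {μ : Measure X} {f g : X → ℝ}
    (hf : MemLp f 2 μ) (hg : MemLp g 2 μ) :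
    |∫ x, f x * g x ∂μ| ≤ (eLpNorm f 2 μ).toReal * (eLpNorm g 2 μ).toReal := by
  have h := abs_integral_inner_le hg hf
  rw [mul_comm]
  simpa [RCLike.inner_apply] using h


/-- Test functions are dense in L²: anything orthogonal to all of them vanishes almost everywhere.
The bound therefore passes to the closure, where `D` itself may be used as test function. -/
theorem eLpNorm_le_of_forall_abs_integral_mul_le {A : Set (E d)} (hA : IsOpen A) {D : E d → ℝ}
    (hD : MemLp D 2 (volume.restrict A)) {M : ℝ} (hM : 0 ≤ M)
    (h : ∀ φ : E d → ℝ, ContDiff ℝ ∞ φ → HasCompactSupport φ → tsupport φ ⊆ A →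
      |∫ x in A, D x * φ x| ≤ M * (eLpNorm φ 2 (volume.restrict A)).toReal) :
    eLpNorm D 2 (volume.restrict A) ≤ ENNReal.ofReal M := by
  let S : Submodule ℝ (Lp ℝ 2 (volume.restrict A)) :=
    { carrier := {f | ∃ φ : E d → ℝ, ContDiff ℝ ∞ φ ∧ HasCompactSupport φ ∧ tsupport φ ⊆ A ∧
        f =ᵐ[volume.restrict A] φ}
      add_mem' := by
        rintro f g ⟨φ, h1, h2, h3, h4⟩ ⟨ψ, k1, k2, k3, k4⟩
        refine ⟨φ + ψ, h1.add k1, h2.add k2,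
          (tsupport_add φ ψ).trans (Set.union_subset h3 k3), ?_⟩
        exact (Lp.coeFn_add f g).trans (h4.add k4)
      zero_mem' := ⟨0, contDiff_const, HasCompactSupport.zero, by simp [tsupport],
        Lp.coeFn_zero _ _ _⟩
      smul_mem' := by
        rintro c f ⟨φ, h1, h2, h3, h4⟩
        refine ⟨c • φ, contDiff_const.smul h1, h2.mono (Function.support_const_smul_subset c φ),
          (closure_mono (Function.support_const_smul_subset c φ)).trans h3, ?_⟩
        exact (Lp.coeFn_smul c f).trans (h4.const_smul c) }
  have hphi : ∀ φ : E d → ℝ, ContDiff ℝ ∞ φ → HasCompactSupport φ →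
      MemLp φ 2 (volume.restrict A) := fun φ h1 h2 =>
    h1.continuous.memLp_of_hasCompactSupport h2
  have hS : S.topologicalClosure = ⊤ := by
    rw [Submodule.topologicalClosure_eq_top_iff, Submodule.eq_bot_iff]
    intro f hf
    rw [Submodule.mem_orthogonal] at hf
    have h0 : ∀ᵐ x ∂(volume.restrict A), x ∈ A → f x = 0 := by
      apply hA.ae_eq_zero_of_integral_contDiff_smul_eq_zero
      · exact ((Lp.memLp f).locallyIntegrable (by norm_num)).locallyIntegrableOn A
      · intro φ h1 h2 h3
        have h4 := hf ((hphi φ h1 h2).toLp φ) ⟨φ, h1, h2, h3, (hphi φ h1 h2).coeFn_toLp⟩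
        rw [L2.inner_def] at h4
        rw [← h4]
        apply integral_congr_ae
        filter_upwards [(hphi φ h1 h2).coeFn_toLp] with x hx
        rw [hx]
        simp [mul_comm]
    rw [Lp.eq_zero_iff_ae_eq_zero]
    filter_upwards [h0, ae_restrict_mem hA.measurableSet] with x h1 h2 using h1 h2
  have hcl : IsClosed {f : Lp ℝ 2 (volume.restrict A) | |inner ℝ (hD.toLp D) f| ≤ M * ‖f‖} :=
    isClosed_le (by fun_prop) (by fun_prop)
  have hsub : (S.topologicalClosure : Set (Lp ℝ 2 (volume.restrict A))) ⊆
      {f | |inner ℝ (hD.toLp D) f| ≤ M * ‖f‖} := by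
    rw [Submodule.topologicalClosure_coe]
    refine closure_minimal ?_ hcl
    rintro f ⟨φ, h1, h2, h3, h4⟩
    have h5 := h φ h1 h2 h3
    rw [Set.mem_ofPred_eq, L2.inner_def, Lp.norm_def, eLpNorm_congr_ae h4]
    convert h5 using 2
    apply integral_congr_ae
    filter_upwards [h4, hD.coeFn_toLp] with x h1 h2
    rw [h1, h2]
    simp [mul_comm]
  have hDm : hD.toLp D ∈ S.topologicalClosure := by rw [hS]; trivial
  have h1 := hsub hDm
  rw [Set.mem_ofPred_eq, real_inner_self_eq_norm_sq, abs_of_nonneg (by positivity), sq] at h1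
  have h2 : ‖hD.toLp D‖ ≤ M := by
    by_contra hc
    push Not at hc
    have h3 : 0 < ‖hD.toLp D‖ := hM.trans_lt hc
    exact absurd (le_of_mul_le_mul_right h1 h3) (not_le.2 hc)
  rw [Lp.norm_toLp] at h2
  exact (ENNReal.le_ofReal_iff_toReal_le hD.2.ne hM).2 h2

/-- Linearity in the direction extends the coordinate identities to an arbitrary vector, as
translations require. -/
theorem IsWeakGradient.integral_mul_fderiv {Ω : Set (E d)} {v : E d → ℝ} {G : E d → E d}
    (h : IsWeakGradient Ω v G) {φ : E d → ℝ} (h1 : ContDiff ℝ ∞ φ) (h2 : HasCompactSupport φ)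
    (h3 : tsupport φ ⊆ Ω) (e : E d) :
    ∫ x in Ω, v x * fderiv ℝ φ x e = -∫ x in Ω, inner ℝ (G x) (φ x • e) := by
  have hfc : Continuous (fun x => fderiv ℝ φ x) := h1.continuous_fderiv (by simp)
  have hfs : HasCompactSupport (fun x => fderiv ℝ φ x) := h2.fderiv ℝ
  have he : e = ∑ i, e i • EuclideanSpace.single i (1 : ℝ) := by
    ext j
    simp [Finset.sum_apply, Pi.single_apply]
  have e1 : ∀ x, v x * fderiv ℝ φ x e =
      ∑ i, e i * (v x * fderiv ℝ φ x (EuclideanSpace.single i 1)) := by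
    intro x
    conv_lhs => rw [he]
    rw [map_sum, Finset.mul_sum]
    refine Finset.sum_congr rfl fun i _ => ?_
    rw [map_smul, smul_eq_mul]; ring
  have e2 : ∀ x, inner ℝ (G x) (φ x • e) = ∑ i, e i * (G x i * φ x) := by
    intro x
    rw [inner_smul_right, PiLp.inner_apply, Finset.mul_sum]
    refine Finset.sum_congr rfl fun i _ => ?_
    simp; ring
  simp_rw [e1, e2]
  rw [integral_finsetSum, integral_finsetSum, ← Finset.sum_neg_distrib]
  · refine Finset.sum_congr rfl fun i _ => ?_
    rw [integral_const_mul, integral_const_mul, h.integral_eq φ h1 h2 h3 i]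
    ring
  · intro i _
    apply Integrable.const_mul
    have : MemLp φ 2 (volume.restrict Ω) := h1.continuous.memLp_of_hasCompactSupport h2
    have hG : MemLp (fun x => G x i) 2 (volume.restrict Ω) :=
      h.memLp_grad.continuousLinearMap_comp (EuclideanSpace.proj i : E d →L[ℝ] ℝ)
    exact hG.integrable_mul this
  · intro i _
    apply Integrable.const_mul
    have hs : HasCompactSupport (fun x => fderiv ℝ φ x (EuclideanSpace.single i 1)) :=
      h2.fderiv_apply ℝ _
    have : MemLp (fun x => fderiv ℝ φ x (EuclideanSpace.single i 1)) 2 (volume.restrict Ω) :=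
      (hfc.clm_apply continuous_const).memLp_of_hasCompactSupport hs
    exact h.memLp.integrable_mul this

/-- An `H¹` function moves in `L²` by at most `‖e‖ ‖∇v‖` under a translation by `e` that stays
inside the domain. -/
theorem IsWeakGradient.eLpNorm_translate_sub_le {Ω A : Set (E d)} {v : E d → ℝ} {G : E d → E d}
    (h : IsWeakGradient Ω v G) (hΩ : MeasurableSet Ω) (hfin : volume Ω ≠ ⊤) (hA : IsOpen A)
    {e : E d} (hAe : ∀ y ∈ A, ∀ s ∈ Set.Icc (0 : ℝ) 1, y + s • e ∈ Ω) :
    eLpNorm (fun y => v (y + e) - v y) 2 (volume.restrict A) ≤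
      ENNReal.ofReal ‖e‖ * eLpNorm G 2 (volume.restrict Ω) := by
  have : IsFiniteMeasure (volume.restrict Ω) := ⟨by simpa using hfin.lt_top⟩
  have hA0 : A ⊆ Ω := fun y hy => by simpa using hAe y hy 0 (by simp)
  have hA1 : A ⊆ (fun y => y + e) ⁻¹' Ω := fun y hy => by simpa using hAe y hy 1 (by simp)
  have hve : MemLp (fun y => v (y + e)) 2 (volume.restrict A) :=
    (h.memLp.comp_measurePreserving
      ((measurePreserving_add_right volume e).restrict_preimage hΩ)).mono_measure
      (Measure.restrict_mono hA1 le_rfl)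
  have hv : MemLp v 2 (volume.restrict A) := h.memLp.mono_measure (Measure.restrict_mono hA0 le_rfl)
  have hGtop : eLpNorm G 2 (volume.restrict Ω) ≠ ⊤ := h.memLp_grad.2.ne
  rw [← ENNReal.ofReal_toReal hGtop, ← ENNReal.ofReal_mul (norm_nonneg _)]
  refine eLpNorm_le_of_forall_abs_integral_mul_le hA (hve.sub hv) (by positivity) ?_
  intro φ h1 h2 h3
  obtain ⟨C, hC⟩ := (h2.fderiv (𝕜 := ℝ)).exists_bound_of_continuous
    (h1.continuous_fderiv (by simp))
  obtain ⟨C', hC'⟩ := h2.exists_bound_of_continuous h1.continuous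
  have hvi : Integrable v (volume.restrict Ω) := h.memLp.integrable (by norm_num)
  have hφc : ∀ s : ℝ, Continuous fun y => φ (y - s • e) := fun s =>
    h1.continuous.comp (continuous_id.sub continuous_const)
  have hFi : ∀ s : ℝ, Integrable (fun y => v y * φ (y - s • e)) (volume.restrict Ω) := fun s =>
    hvi.mul_bdd (hφc s).aestronglyMeasurable (ae_of_all _ fun y => hC' _)
  -- The pairing of `v(· + e) - v` with `φ` is `I(1) - I(0)` for `I(s) = ∫ v φ(· - s e)`. The mean
  -- value inequality applies once `I'` is bounded by the weak gradient.
  have hder : ∀ s : ℝ, HasDerivAt (fun s : ℝ => ∫ y in Ω, v y * φ (y - s • e))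
      (∫ y in Ω, v y * fderiv ℝ φ (y - s • e) (-e)) s := by
    intro s
    refine (hasDerivAt_integral_of_dominated_loc_of_deriv_le (s := Set.univ)
      (bound := fun y => |v y| * (C * ‖e‖))
      (F' := fun s y => v y * fderiv ℝ φ (y - s • e) (-e)) Filter.univ_mem ?_ (hFi s) ?_ ?_ ?_ ?_).2
    · exact Eventually.of_forall fun s => (hFi s).1
    · refine hvi.1.mul (Continuous.aestronglyMeasurable ?_)
      exact ((h1.continuous_fderiv (by simp)).comp
        (continuous_id.sub continuous_const)).clm_apply continuous_const
    · refine ae_of_all _ fun y s _ => ?_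
      rw [norm_mul, Real.norm_eq_abs]
      gcongr
      calc ‖fderiv ℝ φ (y - s • e) (-e)‖ ≤ ‖fderiv ℝ φ (y - s • e)‖ * ‖-e‖ :=
            ContinuousLinearMap.le_opNorm _ _
        _ ≤ C * ‖e‖ := by rw [norm_neg]; gcongr; exact hC _
    · exact hvi.abs.mul_const _
    · refine ae_of_all _ fun y s _ => ?_
      have hd : HasFDerivAt φ (fderiv ℝ φ (y - s • e)) (y - s • e) :=
        (h1.differentiable (by simp) _).hasFDerivAt
      have hl : HasDerivAt (fun s : ℝ => y - s • e) (-e) s := by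
        simpa using ((hasDerivAt_id s).smul_const e).const_sub y
      exact (hd.comp_hasDerivAt s hl).const_mul (v y)
  have hnorm : ∀ s : ℝ, eLpNorm (fun y => φ (y - s • e)) 2 (volume.restrict Ω) ≤
      eLpNorm φ 2 (volume.restrict A) := by
    intro s
    calc eLpNorm (fun y => φ (y - s • e)) 2 (volume.restrict Ω)
        ≤ eLpNorm (fun y => φ (y - s • e)) 2 volume :=
          eLpNorm_mono_measure _ Measure.restrict_le_self
      _ = eLpNorm φ 2 volume :=
          eLpNorm_comp_measurePreserving h1.continuous.aestronglyMeasurable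
            (measurePreserving_sub_right volume (s • e))
      _ = eLpNorm φ 2 (volume.restrict A) := by
          rw [eLpNorm_restrict_eq_of_support_subset ((subset_tsupport φ).trans h3)]
  have hbound : ∀ s ∈ Set.Icc (0 : ℝ) 1, ‖∫ y in Ω, v y * fderiv ℝ φ (y - s • e) (-e)‖ ≤
      ‖e‖ * (eLpNorm G 2 (volume.restrict Ω)).toReal *
        (eLpNorm φ 2 (volume.restrict A)).toReal := by
    intro s hs
    have k1 : ContDiff ℝ ∞ fun y => φ (y - s • e) := h1.comp (contDiff_id.sub contDiff_const)
    have k2 : HasCompactSupport fun y => φ (y - s • e) :=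
      h2.comp_homeomorph (Homeomorph.subRight (s • e))
    -- The whole path of the translation stays in `Ω`, so every translate of `φ` is an admissible
    -- test function.
    have k3 : tsupport (fun y => φ (y - s • e)) ⊆ Ω := by
      have := tsupport_comp_eq_preimage φ (Homeomorph.subRight (s • e))
      intro y hy
      have hy' : y - s • e ∈ tsupport φ := by
        have hy2 : y ∈ tsupport (φ ∘ (Homeomorph.subRight (s • e))) := hy
        rw [this] at hy2
        exact hy2
      simpa using hAe _ (h3 hy') s hs
    have k4 : ∀ y, fderiv ℝ φ (y - s • e) (-e) = -fderiv ℝ (fun y => φ (y - s • e)) y e := by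
      intro y
      rw [fderiv_comp_sub (s • e), map_neg]
    simp_rw [k4, mul_neg]
    rw [integral_neg, h.integral_mul_fderiv k1 k2 k3 e, neg_neg, Real.norm_eq_abs]
    have hm : MemLp (fun y => φ (y - s • e) • e) 2 (volume.restrict Ω) :=
      (k1.continuous.smul continuous_const).memLp_of_hasCompactSupport
        (k2.smul_right)
    refine (abs_integral_inner_le h.memLp_grad hm).trans ?_
    have : eLpNorm (fun y => φ (y - s • e) • e) 2 (volume.restrict Ω) ≤
        ENNReal.ofReal ‖e‖ * eLpNorm φ 2 (volume.restrict A) := by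
      refine (eLpNorm_le_mul_eLpNorm_of_ae_le_mul (c := ‖e‖) (g := fun y => φ (y - s • e)) ?_ 2).trans ?_
      · refine ae_of_all _ fun y => ?_
        rw [norm_smul, mul_comm]
      · gcongr; exact hnorm s
    have htop : eLpNorm φ 2 (volume.restrict A) ≠ ⊤ :=
      (h1.continuous.memLp_of_hasCompactSupport h2).2.ne
    have h6 := ENNReal.toReal_mono (by finiteness) this
    rw [ENNReal.toReal_mul, ENNReal.toReal_ofReal (norm_nonneg _)] at h6
    calc _ ≤ (eLpNorm G 2 (volume.restrict Ω)).toReal *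
          (‖e‖ * (eLpNorm φ 2 (volume.restrict A)).toReal) := by gcongr
      _ = _ := by ring
  have hmv := (convex_Icc (0 : ℝ) 1).norm_image_sub_le_of_norm_hasDerivWithin_le
    (fun s _ => (hder s).hasDerivWithinAt) hbound (Set.left_mem_Icc.2 zero_le_one)
    (Set.right_mem_Icc.2 zero_le_one)
  have hφ2 : MemLp φ 2 (volume.restrict A) := h1.continuous.memLp_of_hasCompactSupport h2
  have hsupp : ∀ y, y ∉ A → φ y = 0 := fun y hy => image_eq_zero_of_notMem_tsupport fun hh => hy (h3 hh)
  classical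
  have i1 : ∫ y in Ω, v y * φ (y - (1 : ℝ) • e) = ∫ y in A, v (y + e) * φ y := by
    rw [← integral_indicator hΩ, ← integral_indicator hA.measurableSet,
      ← integral_add_right_eq_self _ e]
    congr 1
    ext y
    by_cases hy : y ∈ A
    · rw [Set.indicator_of_mem (show y + e ∈ Ω from hA1 hy), Set.indicator_of_mem hy]; simp
    · rw [Set.indicator_of_notMem hy, Set.indicator_apply]; simp [hsupp y hy]
  have i0 : ∫ y in Ω, v y * φ (y - (0 : ℝ) • e) = ∫ y in A, v y * φ y := by
    rw [← integral_indicator hΩ, ← integral_indicator hA.measurableSet]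
    congr 1
    ext y
    by_cases hy : y ∈ A
    · rw [Set.indicator_of_mem (hA0 hy), Set.indicator_of_mem hy]; simp
    · rw [Set.indicator_of_notMem hy, Set.indicator_apply]; simp [hsupp y hy]
  have j1 : Integrable (fun y => v (y + e) * φ y) (volume.restrict A) := hve.integrable_mul hφ2
  have j0 : Integrable (fun y => v y * φ y) (volume.restrict A) := hv.integrable_mul hφ2
  rw [i1, i0, ← integral_sub j1 j0] at hmv
  simpa [sub_mul] using hmv

/-! ### The Poincaré inequality on pieces of the domain, and gluing -/

theorem IsWeakGradient.congr {Ω : Set (E d)} {v w : E d → ℝ} {G K : E d → E d}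
    (h : IsWeakGradient Ω v G) (hv : v =ᵐ[volume.restrict Ω] w)
    (hG : G =ᵐ[volume.restrict Ω] K) : IsWeakGradient Ω w K where
  memLp := (memLp_congr_ae hv).1 h.memLp
  memLp_grad := (memLp_congr_ae hG).1 h.memLp_grad
  integral_eq φ h1 h2 h3 i := by
    have e1 := h.integral_eq φ h1 h2 h3 i
    rw [integral_congr_ae (g := fun x => w x * fderiv ℝ φ x (EuclideanSpace.single i 1)),
      integral_congr_ae (f := fun x => G x i * φ x) (g := fun x => K x i * φ x)] at e1
    · exact e1
    · filter_upwards [hG] with x hx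
      rw [hx]
    · filter_upwards [hv] with x hx
      rw [hx]

theorem eLpNorm_two_sq {X V : Type*} [MeasurableSpace X] [NormedAddCommGroup V] (f : X → V)
    (μ : Measure X) : eLpNorm f 2 μ ^ 2 = ∫⁻ x, ‖f x‖ₑ ^ 2 ∂μ := by
  have := eLpNorm_nnreal_pow_eq_lintegral (f := f) (μ := μ) (p := 2) (by norm_num)
  simpa using this

theorem eLpNorm_two_restrict_union_le {X V : Type*} [MeasurableSpace X] [NormedAddCommGroup V]
    (f : X → V) (μ : Measure X) (A B : Set X) :
    eLpNorm f 2 (μ.restrict (A ∪ B)) ≤ eLpNorm f 2 (μ.restrict A) + eLpNorm f 2 (μ.restrict B) := by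
  rw [← ENNReal.pow_le_pow_left_iff (two_ne_zero), eLpNorm_two_sq]
  calc ∫⁻ x in A ∪ B, ‖f x‖ₑ ^ 2 ∂μ
      ≤ (∫⁻ x in A, ‖f x‖ₑ ^ 2 ∂μ) + ∫⁻ x in B, ‖f x‖ₑ ^ 2 ∂μ := lintegral_union_le _ _ _
    _ = eLpNorm f 2 (μ.restrict A) ^ 2 + eLpNorm f 2 (μ.restrict B) ^ 2 := by
        rw [eLpNorm_two_sq, eLpNorm_two_sq]
    _ ≤ _ := by
        rw [add_sq]
        gcongr
        exact le_self_add

/-- The Poincaré inequality on the subset `A` of `Ω`, with the gradient measured on all of `Ω`. -/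
def PoincareOn (Ω A : Set (E d)) : Prop :=
  ∃ C : ENNReal, C ≠ ⊤ ∧ ∀ (v : E d → ℝ) (G : E d → E d), IsWeakGradient Ω v G →
    ∃ c : ℝ, eLpNorm (fun x => v x - c) 2 (volume.restrict A) ≤
      C * eLpNorm G 2 (volume.restrict Ω)

/-- Averaging `|v x - v y|²` over pairs in the ball and writing `x = y + h` reduces the claim to
translations by `h` with `‖h‖ < 2δ`. These stay in the ball of radius `3δ`. -/
theorem poincareOn_ball {Ω : Set (E d)} (hΩ : MeasurableSet Ω) (hfin : volume Ω ≠ ⊤) {z : E d}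
    {δ : ℝ} (hδ : 0 < δ) (hz : Metric.ball z (3 * δ) ⊆ Ω) :
    PoincareOn Ω (Metric.ball z δ) := by
  set B := Metric.ball z δ with hB
  set K := Metric.ball (0 : E d) (2 * δ) with hK
  have hBm : MeasurableSet B := Metric.isOpen_ball.measurableSet
  have hKm : MeasurableSet K := Metric.isOpen_ball.measurableSet
  have hB0 : volume B ≠ 0 := (Metric.measure_ball_pos volume z hδ).ne'
  have hBt : volume B ≠ ⊤ := measure_ball_lt_top.ne
  have hKt : volume K ≠ ⊤ := measure_ball_lt_top.ne
  have hBΩ : B ⊆ Ω := (Metric.ball_subset_ball (by linarith)).trans hz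
  set C0 : ENNReal := volume K * ENNReal.ofReal (2 * δ) ^ 2 / volume B with hC0
  have hC0t : C0 ≠ ⊤ := ENNReal.div_ne_top (by finiteness) hB0
  refine ⟨C0 ^ (1 / 2 : ℝ), by finiteness, ?_⟩
  -- Measurability serves for Tonelli; the general case passes to a measurable representative.
  have key : ∀ (v : E d → ℝ) (G : E d → E d), Measurable v → IsWeakGradient Ω v G →
      ∃ c : ℝ, eLpNorm (fun x => v x - c) 2 (volume.restrict B) ≤
        C0 ^ (1 / 2 : ℝ) * eLpNorm G 2 (volume.restrict Ω) := by
    intro v G hv h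
    set g := eLpNorm G 2 (volume.restrict Ω) with hg
    have hmeas : Measurable (Function.uncurry fun y x => ‖v x - v y‖ₑ ^ 2) := by
      simp only [Function.uncurry_def]; fun_prop
    have hΦ : Measurable fun y => ∫⁻ x in B, ‖v x - v y‖ₑ ^ 2 := hmeas.lintegral_prod_right'
    -- Some `y` does no worse than the average, and its value `v y` serves as the constant.
    obtain ⟨y, hy, hle⟩ := exists_le_setLAverage (μ := volume) hB0 hBt hΦ.aemeasurable
    refine ⟨v y, ?_⟩
    rw [← ENNReal.pow_le_pow_left_iff two_ne_zero, eLpNorm_two_sq, mul_pow]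
    have hsq : (C0 ^ (1 / 2 : ℝ)) ^ 2 = C0 := by
      rw [← ENNReal.rpow_natCast, ← ENNReal.rpow_mul]; norm_num
    rw [hsq]
    refine hle.trans ?_
    rw [setLAverage_eq]
    have h1 : ∀ y ∈ B, ∫⁻ x in B, ‖v x - v y‖ₑ ^ 2 ≤ ∫⁻ h in K, ‖v (y + h) - v y‖ₑ ^ 2 := by
      intro y hy
      rw [← lintegral_indicator hBm, ← lintegral_indicator hKm, ← lintegral_add_left_eq_self _ y]
      refine lintegral_mono fun h => ?_
      by_cases hh : y + h ∈ B
      · have hk : h ∈ K := by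
          rw [hB, Metric.mem_ball, dist_eq_norm] at hh hy
          rw [hK, mem_ball_zero_iff]
          calc ‖h‖ = ‖(y + h - z) - (y - z)‖ := by congr 1; abel
            _ ≤ ‖y + h - z‖ + ‖y - z‖ := norm_sub_le _ _
            _ < 2 * δ := by linarith
        rw [Set.indicator_of_mem hh, Set.indicator_of_mem hk]
      · rw [Set.indicator_of_notMem hh]; exact zero_le
    have h2 : ∀ h' ∈ K, ∫⁻ y in B, ‖v (y + h') - v y‖ₑ ^ 2 ≤ (ENNReal.ofReal (2 * δ) * g) ^ 2 := by
      intro e he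
      rw [← eLpNorm_two_sq (fun y => v (y + e) - v y)]
      rw [hK, mem_ball_zero_iff] at he
      gcongr
      refine (h.eLpNorm_translate_sub_le hΩ hfin Metric.isOpen_ball ?_).trans
        (by gcongr)
      intro y hy s hs
      apply hz
      rw [Metric.mem_ball, dist_eq_norm] at hy ⊢
      calc ‖y + s • e - z‖ = ‖(y - z) + s • e‖ := by congr 1; abel
        _ ≤ ‖y - z‖ + |s| * ‖e‖ := (norm_add_le _ _).trans (by rw [norm_smul, Real.norm_eq_abs])
        _ ≤ ‖y - z‖ + 1 * ‖e‖ := by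
            gcongr; rw [abs_of_nonneg hs.1]; exact hs.2
        _ < 3 * δ := by linarith
    have h3 : ∫⁻ y in B, ∫⁻ x in B, ‖v x - v y‖ₑ ^ 2 ≤
        volume K * (ENNReal.ofReal (2 * δ) * g) ^ 2 := by
      calc _ ≤ ∫⁻ y in B, ∫⁻ h in K, ‖v (y + h) - v y‖ₑ ^ 2 := by
            refine setLIntegral_mono' hBm h1
        _ = ∫⁻ h in K, ∫⁻ y in B, ‖v (y + h) - v y‖ₑ ^ 2 := by
            apply lintegral_lintegral_swap
            apply Measurable.aemeasurable
            simp only [Function.uncurry_def]; fun_prop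
        _ ≤ ∫⁻ h in K, (ENNReal.ofReal (2 * δ) * g) ^ 2 := setLIntegral_mono' hKm h2
        _ = _ := by rw [setLIntegral_const, mul_comm]
    calc _ ≤ volume K * (ENNReal.ofReal (2 * δ) * g) ^ 2 / volume B := by gcongr
      _ = C0 * g ^ 2 := by
        rw [hC0, mul_pow, ENNReal.div_eq_inv_mul, ENNReal.div_eq_inv_mul]; ring
  intro v G h
  have hv := h.memLp.1
  obtain ⟨c, hc⟩ := key (hv.mk v) G hv.stronglyMeasurable_mk.measurable
    (h.congr hv.ae_eq_mk (ae_eq_refl G))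
  refine ⟨c, le_of_eq_of_le (eLpNorm_congr_ae ?_) hc⟩
  filter_upwards [ae_restrict_of_ae_restrict_of_subset hBΩ hv.ae_eq_mk] with x hx
  rw [hx]

/-- Both constants approximate `v` on the overlap, which has positive measure. This bounds their
difference, so one of them can serve on both sets. -/
theorem PoincareOn.union {Ω A B : Set (E d)} (hA : PoincareOn Ω A) (hB : PoincareOn Ω B)
    (hAΩ : A ⊆ Ω) (hBΩ : B ⊆ Ω) (hfin : volume Ω ≠ ⊤) (hAB : volume (A ∩ B) ≠ 0) :
    PoincareOn Ω (A ∪ B) := by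
  obtain ⟨C, hC, hA⟩ := hA
  obtain ⟨D, hD, hB⟩ := hB
  have hBt : volume B ≠ ⊤ := measure_ne_top_of_subset hBΩ hfin
  have hABt : volume (A ∩ B) ≠ ⊤ := measure_ne_top_of_subset Set.inter_subset_right hBt
  set m := volume (A ∩ B) ^ (1 / 2 : ℝ) with hm
  set b := volume B ^ (1 / 2 : ℝ) with hb
  have hm0 : m ≠ 0 := by
    rw [hm, Ne, ENNReal.rpow_eq_zero_iff]; norm_num [hAB]
  have hmt : m ≠ ⊤ := by rw [hm]; finiteness
  have hbt : b ≠ ⊤ := by rw [hb]; finiteness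
  refine ⟨C + (D + (C + D) / m * b), ?_, fun v G h => ?_⟩
  · have : (C + D) / m ≠ ⊤ := ENNReal.div_ne_top (by finiteness) hm0
    finiteness
  obtain ⟨a, ha⟩ := hA v G h
  obtain ⟨c, hc⟩ := hB v G h
  refine ⟨a, ?_⟩
  set g := eLpNorm G 2 (volume.restrict Ω) with hg
  have hmeas : ∀ (S : Set (E d)) (r : ℝ), S ⊆ Ω →
      AEStronglyMeasurable (fun x => v x - r) (volume.restrict S) := fun S r hS =>
    (h.memLp.1.mono_measure (Measure.restrict_mono hS le_rfl)).sub aestronglyMeasurable_const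
  have hconst : ∀ S : Set (E d), volume S ≠ 0 → eLpNorm (fun _ : E d => a - c) 2 (volume.restrict S) =
      ‖a - c‖ₑ * volume S ^ (1 / 2 : ℝ) := by
    intro S hS
    rw [eLpNorm_const _ two_ne_zero (by rwa [Ne, Measure.restrict_eq_zero])]
    simp
  have hB0 : volume B ≠ 0 := fun hh => hAB (measure_mono_null Set.inter_subset_right hh)
  have h1 : ‖a - c‖ₑ * m ≤ (C + D) * g := by
    rw [hm, ← hconst _ hAB]
    have e1 : (fun _ : E d => a - c) = (fun x => v x - c) - fun x => v x - a := by
      ext x; simp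
    rw [e1]
    refine (eLpNorm_sub_le (hmeas _ _ (Set.inter_subset_left.trans hAΩ))
      (hmeas _ _ (Set.inter_subset_left.trans hAΩ)) (by norm_num)).trans ?_
    calc _ ≤ eLpNorm (fun x => v x - c) 2 (volume.restrict B) +
          eLpNorm (fun x => v x - a) 2 (volume.restrict A) := by
          gcongr
          · exact Set.inter_subset_right
          · exact Set.inter_subset_left
      _ ≤ D * g + C * g := by gcongr
      _ = _ := by ring
  have h2 : ‖a - c‖ₑ ≤ (C + D) / m * g := by
    rw [← ENNReal.mul_div_right_comm, ENNReal.le_div_iff_mul_le (Or.inl hm0) (Or.inl hmt)]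
    exact h1
  refine (eLpNorm_two_restrict_union_le _ _ _ _).trans ?_
  rw [add_mul]
  gcongr
  have e2 : (fun x => v x - a) = (fun x => v x - c) - fun _ => a - c := by
    ext x; simp
  rw [e2]
  refine (eLpNorm_sub_le (hmeas _ _ hBΩ) aestronglyMeasurable_const (by norm_num)).trans ?_
  rw [hconst _ hB0, add_mul]
  refine add_le_add hc ?_
  calc ‖a - c‖ₑ * b ≤ (C + D) / m * g * b := by gcongr
    _ = _ := by ring

/-- Split `v y - c` into `v (y + e) - c`, controlled on the ball around `x + e`, and the change of
`v` under the shift, controlled by the translation estimate. -/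
theorem poincareOn_inter_ball {Ω : Set (E d)} (hΩ : IsOpen Ω) (hfin : volume Ω ≠ ⊤) {x e : E d}
    {δ : ℝ} (hδ : 0 < δ)
    (hs : ∀ y ∈ Ω ∩ Metric.ball x δ, ∀ s ∈ Set.Icc (0 : ℝ) 1, y + s • e ∈ Ω)
    (hb : Metric.ball (x + e) (3 * δ) ⊆ Ω) : PoincareOn Ω (Ω ∩ Metric.ball x δ) := by
  obtain ⟨C, hC, h⟩ := poincareOn_ball hΩ.measurableSet hfin hδ hb
  refine ⟨ENNReal.ofReal ‖e‖ + C, by finiteness, fun v G hv => ?_⟩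
  obtain ⟨c, hc⟩ := h v G hv
  refine ⟨c, ?_⟩
  set A := Ω ∩ Metric.ball x δ with hA
  have htr := hv.eLpNorm_translate_sub_le hΩ.measurableSet hfin (hΩ.inter Metric.isOpen_ball) hs
  have hA1 : A ⊆ (fun y => y + e) ⁻¹' Ω := fun y hy => by simpa using hs y hy 1 (by simp)
  have hA2 : A ⊆ (fun y => y + e) ⁻¹' Metric.ball (x + e) δ := fun y hy => by
    simpa using hy.2
  have hBΩ : Metric.ball (x + e) δ ⊆ Ω := (Metric.ball_subset_ball (by linarith)).trans hb
  have hmp : ∀ S : Set (E d), MeasurableSet S → MeasurePreserving (fun y : E d => y + e)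
      (volume.restrict ((fun y => y + e) ⁻¹' S)) (volume.restrict S) := fun S hS =>
    (measurePreserving_add_right volume e).restrict_preimage hS
  have hve : AEStronglyMeasurable (fun y => v (y + e)) (volume.restrict A) :=
    (hv.memLp.1.comp_measurePreserving (hmp Ω hΩ.measurableSet)).mono_measure
      (Measure.restrict_mono hA1 le_rfl)
  have hv1 : AEStronglyMeasurable v (volume.restrict A) :=
    hv.memLp.1.mono_measure (Measure.restrict_mono Set.inter_subset_left le_rfl)
  have e1 : (fun y => v y - c) = (fun y => v (y + e) - c) - fun y => v (y + e) - v y := by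
    ext y; simp
  rw [e1]
  refine (eLpNorm_sub_le (hve.sub aestronglyMeasurable_const) (hve.sub hv1) (by norm_num)).trans ?_
  rw [add_mul, add_comm]
  refine add_le_add htr (le_trans ?_ hc)
  have hm : AEStronglyMeasurable (fun y => v y - c) (volume.restrict (Metric.ball (x + e) δ)) :=
    (hv.memLp.1.mono_measure (Measure.restrict_mono hBΩ le_rfl)).sub aestronglyMeasurable_const
  rw [← eLpNorm_comp_measurePreserving hm (hmp _ Metric.isOpen_ball.measurableSet)]
  exact eLpNorm_mono_measure _ (Measure.restrict_mono hA2 le_rfl)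

/-- Every point of the closure has a neighbourhood whose part in `Ω` can be moved inside `Ω` into
a ball that lies well within `Ω`. -/
def IsLocallyShiftable (Ω : Set (E d)) : Prop :=
  ∀ x ∈ closure Ω, ∃ δ > 0, ∃ e : E d,
    (∀ y ∈ Ω ∩ Metric.ball x δ, ∀ s ∈ Set.Icc (0 : ℝ) 1, y + s • e ∈ Ω) ∧
      Metric.ball (x + e) (3 * δ) ⊆ Ω

/-- The Poincaré–Wirtinger inequality. -/
theorem IsLocallyShiftable.poincareOn {Ω : Set (E d)} (h : IsLocallyShiftable Ω) (hΩ : IsOpen Ω)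
    (hc : IsConnected Ω) (hb : Bornology.IsBounded Ω) : PoincareOn Ω Ω := by
  have hfin : volume Ω ≠ ⊤ := hb.measure_lt_top.ne
  choose! δ hδ e he1 he2 using h
  set V : E d → Set (E d) := fun x => Ω ∩ Metric.ball x (δ x) with hV
  have hVo : ∀ x, IsOpen (V x) := fun x => hΩ.inter Metric.isOpen_ball
  have hVP : ∀ x ∈ closure Ω, PoincareOn Ω (V x) := fun x hx =>
    poincareOn_inter_ball hΩ hfin (hδ x hx) (he1 x hx) (he2 x hx)
  have hVn : ∀ x ∈ closure Ω, (V x).Nonempty := fun x hx => by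
    change (Ω ∩ Metric.ball x (δ x)).Nonempty
    rw [Set.inter_comm]
    exact mem_closure_iff.1 hx _ Metric.isOpen_ball (Metric.mem_ball_self (hδ x hx))
  obtain ⟨t, ht, hcov⟩ := hb.isCompact_closure.elim_nhds_subcover
    (fun x => Metric.ball x (δ x)) (fun x hx => Metric.ball_mem_nhds x (hδ x hx))
  have hcovV : Ω = ⋃ x ∈ t, V x := by
    apply Set.Subset.antisymm
    · intro y hy
      obtain ⟨x, hx, hyx⟩ := Set.mem_iUnion₂.1 (hcov (subset_closure hy))
      exact Set.mem_iUnion₂.2 ⟨x, hx, hy, hyx⟩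
    · exact Set.iUnion₂_subset fun x _ => Set.inter_subset_left
  obtain ⟨x0, hx0⟩ : t.Nonempty := by
    obtain ⟨y, hy⟩ := hc.nonempty
    rw [hcovV] at hy
    obtain ⟨x, hx, -⟩ := Set.mem_iUnion₂.1 hy
    exact ⟨x, hx⟩
  classical
  -- Take a maximal nonempty subfamily whose union satisfies the inequality. If it were not the
  -- whole cover, connectedness would make its union meet a remaining piece, and that piece could be
  -- added.
  let P := t.powerset.filter fun S => S.Nonempty ∧ PoincareOn Ω (⋃ x ∈ S, V x)
  have hP : P.Nonempty := ⟨{x0}, by simp [P, hx0, hVP x0 (ht x0 hx0)]⟩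
  obtain ⟨S, hS⟩ := P.exists_maximal hP
  have hSP : S ⊆ t ∧ S.Nonempty ∧ PoincareOn Ω (⋃ x ∈ S, V x) := by
    simpa [P] using hS.1
  obtain ⟨hSt, ⟨x1, hx1⟩, hSP⟩ := hSP
  by_cases hSe : t ⊆ S
  · rw [hSt.antisymm hSe, ← hcovV] at hSP
    exact hSP
  exfalso
  obtain ⟨x2, hx2t, hx2S⟩ := Finset.not_subset.1 hSe
  have hUo : ∀ S : Finset (E d), IsOpen (⋃ x ∈ S, V x) := fun S => isOpen_biUnion fun x _ => hVo x
  have hUΩ : ∀ S : Finset (E d), (⋃ x ∈ S, V x) ⊆ Ω := fun S =>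
    Set.iUnion₂_subset fun x _ => Set.inter_subset_left
  have hne : ∀ S : Finset (E d), S ⊆ t → ∀ x ∈ S, (Ω ∩ ⋃ x ∈ S, V x).Nonempty := by
    intro S hS x hx
    obtain ⟨y, hy⟩ := hVn x (ht x (hS hx))
    exact ⟨y, hy.1, Set.mem_iUnion₂.2 ⟨x, hx, hy⟩⟩
  obtain ⟨y, -, hy1, hy2⟩ := hc.isPreconnected (⋃ x ∈ S, V x) (⋃ x ∈ t \ S, V x) (hUo _) (hUo _)
    (by
      intro y hy
      rw [hcovV] at hy
      obtain ⟨x, hx, hyx⟩ := Set.mem_iUnion₂.1 hy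
      by_cases hxS : x ∈ S
      · exact Or.inl (Set.mem_iUnion₂.2 ⟨x, hxS, hyx⟩)
      · exact Or.inr (Set.mem_iUnion₂.2 ⟨x, Finset.mem_sdiff.2 ⟨hx, hxS⟩, hyx⟩))
    (hne S hSt x1 hx1)
    (hne (t \ S) Finset.sdiff_subset x2 (Finset.mem_sdiff.2 ⟨hx2t, hx2S⟩))
  obtain ⟨x3, hx3, hy3⟩ := Set.mem_iUnion₂.1 hy2
  rw [Finset.mem_sdiff] at hx3
  have hnew : PoincareOn Ω (⋃ x ∈ insert x3 S, V x) := by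
    rw [Finset.set_biUnion_insert]
    refine (hVP x3 (ht x3 hx3.1)).union hSP Set.inter_subset_left (hUΩ S) hfin ?_
    exact (((hVo x3).inter (hUo S)).measure_pos volume ⟨y, hy3, hy1⟩).ne'
  have hmem : insert x3 S ∈ P := by
    simp only [P, Finset.mem_filter, Finset.mem_powerset]
    exact ⟨Finset.insert_subset hx3.1 hSt, Finset.insert_nonempty _ _, hnew⟩
  exact hx3.2 (hS.2 hmem (Finset.subset_insert _ _) (Finset.mem_insert_self _ _))

/-! ### Admissible domains are locally shiftable -/

/-- Shift towards the centre of an inscribed ball: the endpoint lies in that ball, and convexity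
keeps the segment inside. -/
theorem isLocallyShiftable_of_convex {Ω : Set (E d)} (hΩ : IsOpen Ω) (hconv : Convex ℝ Ω)
    (hne : Ω.Nonempty) : IsLocallyShiftable Ω := by
  obtain ⟨c, hc⟩ := hne
  obtain ⟨r, hr, hball⟩ := Metric.isOpen_iff.1 hΩ c hc
  intro x _
  refine ⟨r / 3, by positivity, c - x, ?_, ?_⟩
  · rintro y ⟨hy, hyx⟩ s hs
    have h1 : y + (c - x) ∈ Ω := by
      apply hball
      rw [Metric.mem_ball, dist_eq_norm] at hyx ⊢
      have : y + (c - x) - c = y - x := by abel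
      rw [this]; linarith
    exact hconv.add_smul_mem hy h1 hs
  · rw [add_sub_cancel]
    convert hball using 2
    ring

/-- At a boundary point, shift along a descent direction of the defining function. Strict
differentiability makes that function decrease along this direction uniformly near the point. -/
theorem isLocallyShiftable_of_hasC2Boundary {Ω : Set (E d)} (hΩ : IsOpen Ω)
    (hC : HasC2Boundary Ω) : IsLocallyShiftable Ω := by
  intro x hx
  by_cases hxΩ : x ∈ Ω
  · obtain ⟨r, hr, hball⟩ := Metric.isOpen_iff.1 hΩ x hxΩ
    refine ⟨r / 3, by positivity, 0, fun y hy s _ => by simpa using hy.1, ?_⟩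
    convert hball using 2
    · simp
    · ring
  obtain ⟨U, hU, r, hr, hdr, hUr⟩ := hC x ⟨hx, by rwa [hΩ.interior_eq]⟩
  have hmem : ∀ y ∈ U, (y ∈ Ω ↔ r y < 0) := by
    intro y hy
    have : y ∈ Ω ∩ U ↔ y ∈ {y | r y < 0} ∩ U := by rw [hUr]
    simpa [hy] using this
  have hrx : r x ≤ 0 := by
    have h1 : x ∈ closure (Ω ∩ U) := by
      rw [mem_closure_iff_nhdsWithin_neBot,
        nhdsWithin_inter_of_mem' (mem_nhdsWithin_of_mem_nhds hU)]
      exact mem_closure_iff_nhdsWithin_neBot.1 hx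
    have h2 : Ω ∩ U ⊆ {y | r y ≤ 0} := by
      rw [hUr]; exact fun y hy => le_of_lt (show r y < 0 from hy.1)
    exact closure_minimal h2 (isClosed_le hr.continuous continuous_const) h1
  obtain ⟨e0, he0⟩ : ∃ e0 : E d, fderiv ℝ r x e0 < 0 := by
    by_contra hcon
    push Not at hcon
    apply hdr
    ext y
    have h1 := hcon y
    have h2 := hcon (-y)
    rw [map_neg] at h2
    simp only [zero_apply]
    linarith
  set L := fderiv ℝ r x with hL
  have he0n : 0 < ‖e0‖ := by
    rw [norm_pos_iff]; rintro rfl; simp at he0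
  have hstrict : HasStrictFDerivAt r L x :=
    hr.contDiffAt.hasStrictFDerivAt (by norm_num)
  -- With this tolerance the linearization error over `s • e0` is at most half of the linear
  -- decrease `-s * L e0`.
  have hc : 0 < -L e0 / (2 * ‖e0‖) := by
    apply div_pos <;> linarith
  have hlo := (hstrict.isLittleO.def hc)
  obtain ⟨η, hη, hηs⟩ := Metric.eventually_nhds_iff_ball.1
    (hlo.and (prod_mem_nhds hU hU))
  have hdec : ∀ y ∈ Metric.ball x η, ∀ s : ℝ, 0 < s → y + s • e0 ∈ Metric.ball x η →
      r (y + s • e0) < r y := by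
    intro y hy s hs hys
    have h1 := (hηs (y + s • e0, y) (by rw [← ball_prod_same]; exact ⟨hys, hy⟩)).1
    simp only [add_sub_cancel_left, map_smul, smul_eq_mul, norm_smul, Real.norm_eq_abs,
      abs_of_pos hs] at h1
    have h2 := (abs_le.1 h1).2
    have h3 : -L e0 / (2 * ‖e0‖) * (s * ‖e0‖) = -(s * L e0) / 2 := by
      field_simp
    rw [h3] at h2
    nlinarith
  have hballU : Metric.ball x η ⊆ U := fun y hy =>
    (hηs (y, y) (by rw [← ball_prod_same]; exact ⟨hy, hy⟩)).2.1
  -- The shift has length `η / 2`, so paths starting within `η / 2` of `x` remain in the ball of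
  -- radius `η`.
  set h := η / (2 * ‖e0‖) with hh
  have hh0 : 0 < h := by positivity
  have hhe : h * ‖e0‖ = η / 2 := by rw [hh]; field_simp
  have hxe : x + h • e0 ∈ Metric.ball x η := by
    rw [Metric.mem_ball, dist_eq_norm, add_sub_cancel_left, norm_smul, Real.norm_eq_abs,
      abs_of_pos hh0, hhe]
    linarith
  have hxeΩ : x + h • e0 ∈ Ω :=
    (hmem _ (hballU hxe)).2 ((hdec x (Metric.mem_ball_self hη) h hh0 hxe).trans_le hrx)
  obtain ⟨q, hq, hqs⟩ := Metric.isOpen_iff.1 hΩ _ hxeΩ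
  refine ⟨min (q / 3) (η / 2), by positivity, h • e0, ?_, ?_⟩
  · rintro y ⟨hyΩ, hyx⟩ s hs
    rcases hs.1.eq_or_lt with rfl | hs0
    · simpa using hyΩ
    have hyη : dist y x < η / 2 := hyx.trans_le (min_le_right _ _)
    have hy1 : y ∈ Metric.ball x η := by rw [Metric.mem_ball]; linarith
    have hy2 : y + (s * h) • e0 ∈ Metric.ball x η := by
      rw [Metric.mem_ball, dist_eq_norm]
      rw [dist_eq_norm] at hyη
      calc ‖y + (s * h) • e0 - x‖ = ‖(y - x) + (s * h) • e0‖ := by congr 1; abel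
        _ ≤ ‖y - x‖ + s * h * ‖e0‖ := by
            refine (norm_add_le _ _).trans ?_
            rw [norm_smul, Real.norm_eq_abs, abs_of_pos (by positivity)]
        _ = ‖y - x‖ + s * (η / 2) := by rw [mul_assoc, hhe]
        _ < η := by nlinarith [hs.2]
    rw [smul_smul]
    exact (hmem _ (hballU hy2)).2
      ((hdec y hy1 (s * h) (by positivity) hy2).trans ((hmem y (hballU hy1)).1 hyΩ))
  · refine (Metric.ball_subset_ball ?_).trans hqs
    linarith [min_le_left (q / 3) (η / 2)]

theorem isOpen_cube (L : ℝ) : IsOpen {x : E d | ∀ i, 0 < x i ∧ x i < L} := by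
  simp only [Set.ofPred_forall]
  refine isOpen_iInter_of_finite fun i => ?_
  have hi : Continuous fun x : E d => x i := by fun_prop
  exact (isOpen_lt continuous_const hi).inter (isOpen_lt hi continuous_const)

theorem convex_cube (L : ℝ) : Convex ℝ {x : E d | ∀ i, 0 < x i ∧ x i < L} := by
  intro x hx y hy a b ha hb hab i
  have h := convex_Ioo (0 : ℝ) L (hx i) (hy i) ha hb hab
  simpa using h

theorem cube_nonempty {L : ℝ} (hL : 0 < L) : {x : E d | ∀ i, 0 < x i ∧ x i < L}.Nonempty :=
  ⟨WithLp.toLp 2 fun _ => L / 2, fun i => by constructor <;> simp <;> linarith⟩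

theorem isBounded_cube (L : ℝ) : Bornology.IsBounded {x : E d | ∀ i, 0 < x i ∧ x i < L} := by
  rw [isBounded_iff_forall_norm_le]
  refine ⟨√(∑ _i : Fin d, L ^ 2), fun x hx => ?_⟩
  rw [EuclideanSpace.norm_eq]
  gcongr with i
  rw [Real.norm_eq_abs, abs_of_pos (hx i).1]
  exact (hx i).2.le

/-! ### Mean-zero functions on admissible domains -/

/-- The properties of the admissible domains that matter. -/
structure IsNiceDomain (Ω : Set (E d)) : Prop where
  isOpen : IsOpen Ω
  isConnected : IsConnected Ω
  isBounded : Bornology.IsBounded Ω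
  isLocallyShiftable : IsLocallyShiftable Ω

theorem BoundaryCondition.IsDomain.isNiceDomain {bc : BoundaryCondition} {Ω : Set (E d)}
    (h : bc.IsDomain Ω) : IsNiceDomain Ω := by
  cases bc with
  | neumann => exact ⟨h.1, h.2.1, h.2.2.1, isLocallyShiftable_of_hasC2Boundary h.1 h.2.2.2⟩
  | periodic L =>
    obtain ⟨hL, rfl⟩ := h
    exact ⟨isOpen_cube L, (convex_cube L).isConnected (cube_nonempty hL), isBounded_cube L,
      isLocallyShiftable_of_convex (isOpen_cube L) (convex_cube L) (cube_nonempty hL)⟩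

namespace IsNiceDomain

variable {Ω : Set (E d)}

theorem measurableSet (h : IsNiceDomain Ω) : MeasurableSet Ω := h.isOpen.measurableSet

theorem isFiniteMeasure (h : IsNiceDomain Ω) : IsFiniteMeasure (volume.restrict Ω) :=
  ⟨by simpa using h.isBounded.measure_lt_top⟩

theorem volume_real_pos (h : IsNiceDomain Ω) : 0 < volume.real Ω :=
  ENNReal.toReal_pos (h.isOpen.measure_pos volume h.isConnected.nonempty).ne'
    h.isBounded.measure_lt_top.ne

theorem memLp_of_continuous {V : Type*} [NormedAddCommGroup V]
    (h : IsNiceDomain Ω) {φ : E d → V} (hφ : Continuous φ) : MemLp φ 2 (volume.restrict Ω) := by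
  have := h.isFiniteMeasure
  obtain ⟨C, hC⟩ := h.isBounded.isCompact_closure.exists_bound_of_continuousOn hφ.continuousOn
  refine MemLp.of_bound (hφ.aestronglyMeasurable) C ?_
  filter_upwards [ae_restrict_mem h.measurableSet] with x hx
  exact hC x (subset_closure hx)

theorem integrable (h : IsNiceDomain Ω) {v : E d → ℝ} (hv : MemLp v 2 (volume.restrict Ω)) :
    Integrable v (volume.restrict Ω) := by
  have := h.isFiniteMeasure
  exact hv.integrable (by norm_num)

theorem memLp_const (h : IsNiceDomain Ω) (c : ℝ) :
    MemLp (fun _ : E d => c) 2 (volume.restrict Ω) := h.memLp_of_continuous continuous_const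

theorem memLp_fluct (h : IsNiceDomain Ω) {v : E d → ℝ} (hv : MemLp v 2 (volume.restrict Ω)) :
    MemLp (fluct Ω v) 2 (volume.restrict Ω) := hv.sub (h.memLp_const _)

theorem integral_fluct (h : IsNiceDomain Ω) {v : E d → ℝ} (hv : MemLp v 2 (volume.restrict Ω)) :
    ∫ x in Ω, fluct Ω v x = 0 := by
  unfold fluct
  rw [integral_sub (h.integrable hv) (h.integrable (h.memLp_const _)), setIntegral_const, mean,
    smul_eq_mul, mul_div_cancel₀ _ h.volume_real_pos.ne', sub_self]

theorem integral_mul_const_of_integral_eq_zero {g : E d → ℝ} (h0 : ∫ x in Ω, g x = 0) (c : ℝ) :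
    ∫ x in Ω, g x * c = 0 := by
  rw [integral_mul_const, h0, zero_mul]

theorem integral_mul_sub_const (h : IsNiceDomain Ω) {g χ : E d → ℝ}
    (hg : MemLp g 2 (volume.restrict Ω)) (h0 : ∫ x in Ω, g x = 0)
    (hχ : MemLp χ 2 (volume.restrict Ω)) (c : ℝ) :
    ∫ x in Ω, g x * (χ x - c) = ∫ x in Ω, g x * χ x := by
  have e1 : Integrable (fun x => g x * χ x) (volume.restrict Ω) := hg.integrable_mul hχ
  have e2 : Integrable (fun x => g x * c) (volume.restrict Ω) := (h.integrable hg).mul_const c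
  simp_rw [mul_sub]
  rw [integral_sub e1 e2, integral_mul_const_of_integral_eq_zero h0, sub_zero]

/-- The mean is the best constant in L²: the fluctuation is orthogonal to constants, so its squared
norm equals its pairing with `v - c` for any `c`. -/
theorem exists_poincare (h : IsNiceDomain Ω) : ∃ C : ℝ, 0 < C ∧
    ∀ (v : E d → ℝ) (G : E d → E d), IsWeakGradient Ω v G →
      (eLpNorm (fluct Ω v) 2 (volume.restrict Ω)).toReal ≤
        C * (eLpNorm G 2 (volume.restrict Ω)).toReal := by
  obtain ⟨C, hC, hP⟩ := h.isLocallyShiftable.poincareOn h.isOpen h.isConnected h.isBounded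
  refine ⟨C.toReal + 1, by positivity, fun v G hv => ?_⟩
  obtain ⟨c, hc⟩ := hP v G hv
  have hf := h.memLp_fluct hv.memLp
  have hw : MemLp (fun x => v x - c) 2 (volume.restrict Ω) := hv.memLp.sub (h.memLp_const c)
  have hc' := ENNReal.toReal_mono (ENNReal.mul_ne_top hC hv.memLp_grad.2.ne) hc
  rw [ENNReal.toReal_mul] at hc'
  set a := (eLpNorm (fluct Ω v) 2 (volume.restrict Ω)).toReal with ha
  have h1 : a * a ≤ a * (eLpNorm (fun x => v x - c) 2 (volume.restrict Ω)).toReal := by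
    have e1 : ∫ x in Ω, fluct Ω v x * fluct Ω v x = a * a := by
      have := real_inner_self_eq_norm_mul_norm (hf.toLp _)
      rw [Lp.norm_toLp, L2.inner_def] at this
      rw [ha, ← this]
      apply integral_congr_ae
      filter_upwards [hf.coeFn_toLp] with x hx
      rw [hx]; simp [sq]
    rw [← e1]
    have e2 : ∫ x in Ω, fluct Ω v x * fluct Ω v x = ∫ x in Ω, fluct Ω v x * (v x - c) := by
      rw [h.integral_mul_sub_const hf (h.integral_fluct hv.memLp) hv.memLp]
      exact h.integral_mul_sub_const hf (h.integral_fluct hv.memLp) hv.memLp _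
    rw [e2]
    exact (le_abs_self _).trans (abs_integral_mul_le hf hw)
  have ha0 : 0 ≤ a := ENNReal.toReal_nonneg
  have hb0 : 0 ≤ (eLpNorm G 2 (volume.restrict Ω)).toReal := ENNReal.toReal_nonneg
  rcases ha0.eq_or_lt with h0 | h0
  · rw [← h0]; positivity
  · have := le_of_mul_le_mul_left h1 h0
    linarith

end IsNiceDomain

/-! ### Integration by parts without boundary term -/

section IntegrationByParts

variable {Ω : Set (E d)} {v w φ : E d → ℝ} {G K : E d → E d}

/-- Integration by parts against `φ` without boundary term. -/
def HasIBP (Ω : Set (E d)) (v : E d → ℝ) (G : E d → E d) (φ : E d → ℝ) : Prop :=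
  ∀ i, ∫ x in Ω, v x * fderiv ℝ φ x (EuclideanSpace.single i 1) = -∫ x in Ω, G x i * φ x

theorem HasIBP.congr (h : HasIBP Ω v G φ) (hv : v =ᵐ[volume.restrict Ω] w)
    (hG : G =ᵐ[volume.restrict Ω] K) : HasIBP Ω w K φ := by
  intro i
  have e1 := h i
  rw [integral_congr_ae (g := fun x => w x * fderiv ℝ φ x (EuclideanSpace.single i 1)),
    integral_congr_ae (f := fun x => G x i * φ x) (g := fun x => K x i * φ x)] at e1
  · exact e1
  · filter_upwards [hG] with x hx
    rw [hx]
  · filter_upwards [hv] with x hx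
    rw [hx]

theorem memLp_coord (hG : MemLp G 2 (volume.restrict Ω)) (i : Fin d) :
    MemLp (fun x => G x i) 2 (volume.restrict Ω) :=
  hG.continuousLinearMap_comp (EuclideanSpace.proj i : E d →L[ℝ] ℝ)

theorem HasIBP.add (hΩ : IsNiceDomain Ω) (hφ : ContDiff ℝ ∞ φ) (hv : MemLp v 2 (volume.restrict Ω))
    (hw : MemLp w 2 (volume.restrict Ω)) (hG : MemLp G 2 (volume.restrict Ω))
    (hK : MemLp K 2 (volume.restrict Ω)) (h : HasIBP Ω v G φ) (h' : HasIBP Ω w K φ) :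
    HasIBP Ω (v + w) (G + K) φ := by
  intro i
  have hd : MemLp (fun x => fderiv ℝ φ x (EuclideanSpace.single i 1)) 2 (volume.restrict Ω) :=
    hΩ.memLp_of_continuous ((hφ.continuous_fderiv (by simp)).clm_apply continuous_const)
  have hp := hΩ.memLp_of_continuous hφ.continuous
  simp only [Pi.add_apply, PiLp.add_apply, add_mul]
  have i1 : Integrable (fun x => v x * fderiv ℝ φ x (EuclideanSpace.single i 1))
    (volume.restrict Ω) := hv.integrable_mul hd
  have i2 : Integrable (fun x => w x * fderiv ℝ φ x (EuclideanSpace.single i 1))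
    (volume.restrict Ω) := hw.integrable_mul hd
  have i3 : Integrable (fun x => G x i * φ x) (volume.restrict Ω) :=
    (memLp_coord hG i).integrable_mul hp
  have i4 : Integrable (fun x => K x i * φ x) (volume.restrict Ω) :=
    (memLp_coord hK i).integrable_mul hp
  rw [integral_add i1 i2, integral_add i3 i4, h i, h' i]
  ring

theorem HasIBP.const_smul (h : HasIBP Ω v G φ) (c : ℝ) : HasIBP Ω (c • v) (c • G) φ := by
  intro i
  simp only [Pi.smul_apply, PiLp.smul_apply, smul_eq_mul, mul_assoc]
  rw [integral_const_mul, integral_const_mul, h i]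
  ring

theorem hasIBP_const (c : ℝ)
    (h : ∀ i, ∫ x in Ω, fderiv ℝ φ x (EuclideanSpace.single i 1) = 0) :
    HasIBP Ω (fun _ => c) (fun _ => 0) φ := by
  intro i
  rw [integral_const_mul, h i]
  simp

theorem integral_fderiv_eq_zero_of_hasCompactSupport (hφ : ContDiff ℝ ∞ φ)
    (hc : HasCompactSupport φ) (hs : tsupport φ ⊆ Ω) (e : E d) :
    ∫ x in Ω, fderiv ℝ φ x e = 0 := by
  have hfc : Continuous (fun x => fderiv ℝ φ x e) :=
    (hφ.continuous_fderiv (by simp)).clm_apply continuous_const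
  have hfs : HasCompactSupport (fun x => fderiv ℝ φ x e) := hc.fderiv_apply ℝ e
  rw [setIntegral_eq_integral_of_forall_compl_eq_zero]
  · have := integral_mul_fderiv_eq_neg_fderiv_mul_of_integrable (𝕜 := ℝ) (μ := (volume : Measure (E d)))
      (f := fun _ => (1 : ℝ)) (g := φ) (v := e)
      (by simp) (by simpa using hfc.integrable_of_hasCompactSupport hfs)
      (by simpa using hφ.continuous.integrable_of_hasCompactSupport hc)
      (by fun_prop) (fun x _ => hφ.differentiable (by simp) x)
    simpa using this
  · intro x hx
    have : x ∉ tsupport (fderiv ℝ φ) := fun h => hx (hs (tsupport_fderiv_subset ℝ h))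
    rw [image_eq_zero_of_notMem_tsupport this]
    simp

/-- In the divergence theorem on the box, the contributions of opposite faces cancel by periodicity.
-/
theorem integral_fderiv_cube_eq_zero_of_periodic {L : ℝ} (hL : 0 < L) (hφ : ContDiff ℝ ∞ φ)
    (hper : ∀ x i, φ (x + L • EuclideanSpace.single i 1) = φ x) (i : Fin d) :
    ∫ x in {x : E d | ∀ i, 0 < x i ∧ x i < L}, fderiv ℝ φ x (EuclideanSpace.single i 1) = 0 := by
  obtain ⟨n, rfl⟩ : ∃ n, d = n + 1 := ⟨d - 1, by have := i.2; omega⟩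
  let T : (Fin (n + 1) → ℝ) →L[ℝ] E (n + 1) :=
    ((PiLp.continuousLinearEquiv 2 ℝ (fun _ : Fin (n + 1) => ℝ)).symm :
      (Fin (n + 1) → ℝ) →L[ℝ] E (n + 1))
  have hT : ∀ x, T x = WithLp.toLp 2 x := fun x => rfl
  have hfc : Continuous (fun x => fderiv ℝ φ x (EuclideanSpace.single i 1)) :=
    (hφ.continuous_fderiv (by simp)).clm_apply continuous_const
  have hdiv := integral_divergence_of_hasFDerivAt_off_countable' (E := ℝ)
    (fun _ : Fin (n + 1) => (0 : ℝ)) (fun _ => L) (fun _ => hL.le)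
    (fun j x => if j = i then φ (T x) else 0)
    (fun j x => if j = i then (fderiv ℝ φ (T x)).comp T else 0) ∅ Set.countable_empty
    (by
      intro j
      split_ifs
      · exact (hφ.continuous.comp T.continuous).continuousOn
      · exact continuousOn_const)
    (by
      intro x _ j
      split_ifs
      · exact ((hφ.differentiable (by simp) _).hasFDerivAt).comp x T.hasFDerivAt
      · exact hasFDerivAt_const _ _)
    (by
      apply Continuous.integrableOn_Icc
      refine continuous_finsetSum _ fun j _ => ?_
      split_ifs
      · exact (((hφ.continuous_fderiv (by simp)).comp T.continuous).clm_comp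
          continuous_const).clm_apply continuous_const
      · simpa using continuous_const)
  have hrhs : ∀ j : Fin (n + 1), ∀ x : Fin n → ℝ,
      (if j = i then φ (T (j.insertNth L x)) else 0) =
        if j = i then φ (T (j.insertNth (0 : ℝ) x)) else 0 := by
    intro j x
    split_ifs with hj
    · rw [← hper (T (j.insertNth (0 : ℝ) x)) j]
      congr 1
      ext k
      rw [hT, hT]
      rcases Fin.eq_self_or_eq_succAbove j k with rfl | ⟨l, rfl⟩
      · simp
      · simp
    · rfl
  simp only [hrhs, sub_self, Finset.sum_const_zero] at hdiv
  rw [← hdiv]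
  have hmp := PiLp.volume_preserving_toLp (Fin (n + 1))
  have hemb : MeasurableEmbedding (WithLp.toLp 2 : (Fin (n + 1) → ℝ) → E (n + 1)) :=
    (MeasurableEquiv.toLp 2 (Fin (n + 1) → ℝ)).measurableEmbedding
  rw [← hmp.setIntegral_preimage_emb hemb]
  have hset : (WithLp.toLp 2 : (Fin (n + 1) → ℝ) → E (n + 1)) ⁻¹'
      {x : E (n + 1) | ∀ i, 0 < x i ∧ x i < L} = Set.univ.pi fun _ => Set.Ioo 0 L := by
    ext x; simp [Set.mem_pi]
  rw [hset]
  have hae : (Set.univ.pi fun _ : Fin (n + 1) => Set.Ioo (0 : ℝ) L) =ᵐ[volume]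
      Set.Icc (fun _ => 0) (fun _ => L) :=
    Measure.univ_pi_Ioo_ae_eq_Icc (μ := fun _ => (volume : Measure ℝ))
  rw [setIntegral_congr_set hae]
  congr 1
  ext x
  rw [Finset.sum_eq_single i]
  · simp only [if_true]
    rfl
  · intro j _ hj
    simp [hj]
  · simp

end IntegrationByParts

/-! ### Riesz representation of the dual norm -/

/-- A bounded functional of the second component of the elements of `S` has a Riesz
representative in the closure of the set of these components. -/
theorem exists_riesz_of_le {H₁ H₂ : Type*} [NormedAddCommGroup H₁] [InnerProductSpace ℝ H₁]
    [NormedAddCommGroup H₂] [InnerProductSpace ℝ H₂] [CompleteSpace H₂]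
    (S : Submodule ℝ (H₁ × H₂)) (g : H₁) (M : ℝ)
    (hM : ∀ z ∈ S, |inner ℝ g z.1| ≤ M * ‖z.2‖) :
    ∃ Z ∈ ((LinearMap.snd ℝ H₁ H₂).comp S.subtype).range.topologicalClosure,
      ∀ z ∈ S, inner ℝ g z.1 = inner ℝ Z z.2 := by
  set π : S →ₗ[ℝ] H₂ := (LinearMap.snd ℝ H₁ H₂).comp S.subtype with hπ
  let l : S →ₗ[ℝ] ℝ := (innerₛₗ ℝ g).comp ((LinearMap.fst ℝ H₁ H₂).comp S.subtype)
  have hbound : ∀ z : S, ‖l z‖ ≤ M * ‖π z‖ := fun z => hM z.1 z.2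
  -- The bound makes `l` vanish where the second component does, so `l` factors through the range of
  -- `π`. Any linear section defines the factor.
  obtain ⟨s, hs⟩ := LinearMap.exists_rightInverse_of_surjective π.rangeRestrict
    (LinearMap.range_rangeRestrict π)
  have hs' : ∀ X : π.range, π (s X) = X := fun X =>
    congrArg Subtype.val (LinearMap.congr_fun hs X)
  let l' : π.range →L[ℝ] ℝ := (l.comp s).mkContinuous M fun X => by
    have := hbound (s X)
    rw [hs'] at this
    exact this
  -- Hahn–Banach extends the factor to the complete space `H₂`. Projecting its Riesz vector onto the
  -- closed range does not change the pairings with the range.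
  obtain ⟨ext, hext, -⟩ := exists_extension_norm_eq π.range l'
  obtain ⟨Z, hZ, Y, hY, hZY⟩ := π.range.topologicalClosure.exists_add_mem_mem_orthogonal
    ((InnerProductSpace.toDual ℝ _).symm ext)
  refine ⟨Z, hZ, fun z hz => ?_⟩
  have hmem : z.2 ∈ π.range := ⟨⟨z, hz⟩, rfl⟩
  have e2 : l ⟨z, hz⟩ = l (s ⟨z.2, hmem⟩) := by
    have h1 := hbound (⟨z, hz⟩ - s ⟨z.2, hmem⟩)
    have h2 : π ⟨z, hz⟩ = z.2 := rfl
    rw [map_sub π, hs', h2, sub_self, norm_zero, mul_zero, norm_le_zero_iff, map_sub,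
      sub_eq_zero] at h1
    exact h1
  have e3 : l (s ⟨z.2, hmem⟩) = ext z.2 := (hext ⟨z.2, hmem⟩).symm
  have e4 : inner ℝ Y z.2 = 0 := by
    rw [real_inner_comm]
    exact (Submodule.mem_orthogonal _ _).1 hY _ (Submodule.le_topologicalClosure _ hmem)
  change l ⟨z, hz⟩ = _
  rw [e2, e3, ← InnerProductSpace.toDual_symm_apply, hZY, inner_add_left, e4, add_zero]

namespace BoundaryCondition

variable {bc : BoundaryCondition} {Ω : Set (E d)} {v w : E d → ℝ} {G K : E d → E d}

/-- The smooth functions against which one integrates by parts without boundary term. -/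
def IsTest : BoundaryCondition → Set (E d) → (E d → ℝ) → Prop
  | .neumann, Ω, φ => HasCompactSupport φ ∧ tsupport φ ⊆ Ω
  | .periodic L, Ω, φ => (HasCompactSupport φ ∧ tsupport φ ⊆ Ω) ∨
      ∀ x i, φ (x + L • EuclideanSpace.single i 1) = φ x

/-- This form treats both boundary conditions at once, so that linearity is proved only once. -/
theorem hasGradient_iff : bc.HasGradient Ω v G ↔ MemLp v 2 (volume.restrict Ω) ∧
    MemLp G 2 (volume.restrict Ω) ∧ ∀ φ, ContDiff ℝ ∞ φ → bc.IsTest Ω φ → HasIBP Ω v G φ := by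
  cases bc with
  | neumann =>
    exact ⟨fun h => ⟨h.memLp, h.memLp_grad, fun φ h1 h2 => h.integral_eq φ h1 h2.1 h2.2⟩,
      fun h => ⟨h.1, h.2.1, fun φ h1 h2 h3 => h.2.2 φ h1 ⟨h2, h3⟩⟩⟩
  | periodic L =>
    refine ⟨fun h => ⟨h.1.memLp, h.1.memLp_grad, fun φ h1 h2 => ?_⟩, fun h =>
      ⟨⟨h.1, h.2.1, fun φ h1 h2 h3 => h.2.2 φ h1 (Or.inl ⟨h2, h3⟩)⟩, fun φ h1 h2 =>
        h.2.2 φ h1 (Or.inr h2)⟩⟩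
    rcases h2 with h2 | h2
    · exact h.1.integral_eq φ h1 h2.1 h2.2
    · exact h.2 φ h1 h2

theorem HasGradient.isWeakGradient (h : bc.HasGradient Ω v G) : IsWeakGradient Ω v G := by
  cases bc with
  | neumann => exact h
  | periodic L => exact h.1

theorem HasGradient.memLp (h : bc.HasGradient Ω v G) : MemLp v 2 (volume.restrict Ω) :=
  h.isWeakGradient.memLp

theorem HasGradient.memLp_grad (h : bc.HasGradient Ω v G) : MemLp G 2 (volume.restrict Ω) :=
  h.isWeakGradient.memLp_grad

theorem HasGradient.congr (h : bc.HasGradient Ω v G) (hv : v =ᵐ[volume.restrict Ω] w)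
    (hG : G =ᵐ[volume.restrict Ω] K) : bc.HasGradient Ω w K := by
  rw [hasGradient_iff] at h ⊢
  exact ⟨(memLp_congr_ae hv).1 h.1, (memLp_congr_ae hG).1 h.2.1, fun φ h1 h2 =>
    (h.2.2 φ h1 h2).congr hv hG⟩

theorem HasGradient.add (hΩ : IsNiceDomain Ω) (h : bc.HasGradient Ω v G)
    (h' : bc.HasGradient Ω w K) : bc.HasGradient Ω (v + w) (G + K) := by
  rw [hasGradient_iff] at h h' ⊢
  exact ⟨h.1.add h'.1, h.2.1.add h'.2.1, fun φ h1 h2 =>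
    HasIBP.add hΩ h1 h.1 h'.1 h.2.1 h'.2.1 (h.2.2 φ h1 h2) (h'.2.2 φ h1 h2)⟩

theorem HasGradient.const_smul (h : bc.HasGradient Ω v G) (c : ℝ) :
    bc.HasGradient Ω (c • v) (c • G) := by
  rw [hasGradient_iff] at h ⊢
  exact ⟨h.1.const_smul c, h.2.1.const_smul c, fun φ h1 h2 => (h.2.2 φ h1 h2).const_smul c⟩

/-- Constants as test functions in Green's formula yield conservation of mass. -/
theorem hasGradient_const (hΩ : bc.IsDomain Ω) (c : ℝ) :
    bc.HasGradient Ω (fun _ => c) (fun _ => 0) := by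
  rw [hasGradient_iff]
  refine ⟨hΩ.isNiceDomain.memLp_const c, MemLp.zero', fun φ h1 h2 => hasIBP_const c fun i => ?_⟩
  cases bc with
  | neumann => exact integral_fderiv_eq_zero_of_hasCompactSupport h1 h2.1 h2.2 _
  | periodic L =>
    rcases h2 with h2 | h2
    · exact integral_fderiv_eq_zero_of_hasCompactSupport h1 h2.1 h2.2 _
    · obtain ⟨hL, rfl⟩ := hΩ
      exact integral_fderiv_cube_eq_zero_of_periodic hL h1 h2 i

/-- The constant is the square of the Poincaré constant: the mean of `χ` may be subtracted, and the
inequality is then applied to both factors. -/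
theorem exists_isGamma (bc : BoundaryCondition) (hΩ : IsNiceDomain Ω) :
    ∃ γ : ℝ, bc.IsGamma Ω γ := by
  obtain ⟨C, hC, h⟩ := hΩ.exists_poincare
  refine ⟨C ^ 2, by positivity, fun v G hv => ?_⟩
  refine iSup_le fun χ => iSup_le fun X => iSup_le fun hX => ENNReal.div_le_of_le_mul ?_
  have hGt := hv.memLp_grad.2.ne
  have hXt := hX.memLp_grad.2.ne
  rw [← ENNReal.ofReal_toReal hGt, ← ENNReal.ofReal_toReal hXt, ← ENNReal.ofReal_mul (by positivity),
    ← ENNReal.ofReal_mul (by positivity)]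
  apply ENNReal.ofReal_le_ofReal
  have hf := hΩ.memLp_fluct hv.memLp
  rw [← hΩ.integral_mul_sub_const hf (hΩ.integral_fluct hv.memLp) hX.memLp (mean Ω χ)]
  refine (abs_integral_mul_le hf (hΩ.memLp_fluct hX.memLp)).trans ?_
  calc _ ≤ (C * (eLpNorm G 2 (volume.restrict Ω)).toReal) *
        (C * (eLpNorm X 2 (volume.restrict Ω)).toReal) := by
        gcongr
        · exact h v G hv.isWeakGradient
        · exact h χ X hX.isWeakGradient
    _ = _ := by ring

/-- The pairs `(v, ∇v)` with `v ∈ Ḣ¹`. -/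
def gradientGraph (bc : BoundaryCondition) (hΩ : bc.IsDomain Ω) :
    Submodule ℝ (Lp ℝ 2 (volume.restrict Ω) × Lp (E d) 2 (volume.restrict Ω)) where
  carrier := {z | bc.HasGradient Ω z.1 z.2}
  add_mem' h h' := (h.add hΩ.isNiceDomain h').congr (Lp.coeFn_add _ _).symm
    (Lp.coeFn_add _ _).symm
  zero_mem' := (hasGradient_const hΩ 0).congr (Lp.coeFn_zero _ _ _).symm (Lp.coeFn_zero _ _ _).symm
  smul_mem' c _ h := (HasGradient.const_smul h c).congr (Lp.coeFn_smul _ _).symm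
    (Lp.coeFn_smul _ _).symm

/-- The gradients of the elements of `Ḣ¹`. -/
def gradientSpace (bc : BoundaryCondition) (hΩ : bc.IsDomain Ω) :
    Submodule ℝ (Lp (E d) 2 (volume.restrict Ω)) :=
  ((LinearMap.snd ℝ _ _).comp (bc.gradientGraph hΩ).subtype).range

theorem HasGradient.toLp_mem (hΩ : bc.IsDomain Ω) (h : bc.HasGradient Ω v G) :
    h.memLp_grad.toLp G ∈ bc.gradientSpace hΩ :=
  ⟨⟨(h.memLp.toLp v, h.memLp_grad.toLp G),
    h.congr h.memLp.coeFn_toLp.symm h.memLp_grad.coeFn_toLp.symm⟩, rfl⟩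

theorem exists_of_mem_gradientSpace (hΩ : bc.IsDomain Ω) {X : Lp (E d) 2 (volume.restrict Ω)}
    (hX : X ∈ bc.gradientSpace hΩ) : ∃ χ : E d → ℝ, bc.HasGradient Ω χ X := by
  obtain ⟨z, rfl⟩ := hX
  exact ⟨z.1.1, z.2⟩

/-- `Z` is the Riesz representative of the functional `χ ↦ (g, χ)` with respect to the inner
product `(∇χ, ∇ψ)`; that is, `Z` is the gradient of `A⁻¹ g`. -/
structure Represents (bc : BoundaryCondition) (hΩ : bc.IsDomain Ω) (g : E d → ℝ)
    (Z : Lp (E d) 2 (volume.restrict Ω)) : Prop where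
  mem : Z ∈ (bc.gradientSpace hΩ).topologicalClosure
  integral_eq : ∀ (χ : E d → ℝ) (X : E d → E d) (h : bc.HasGradient Ω χ X),
    ∫ x in Ω, g x * χ x = inner ℝ Z (h.memLp_grad.toLp X)

theorem exists_represents (hΩ : bc.IsDomain Ω) {g : E d → ℝ}
    (hg : MemLp g 2 (volume.restrict Ω)) (h0 : ∫ x in Ω, g x = 0) :
    ∃ Z, bc.Represents hΩ g Z := by
  have hN := hΩ.isNiceDomain
  obtain ⟨C, hC, hP⟩ := hN.exists_poincare
  have hl : ∀ χ : Lp ℝ 2 (volume.restrict Ω), inner ℝ (hg.toLp g) χ = ∫ x in Ω, g x * χ x := by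
    intro χ
    rw [L2.inner_def]
    apply integral_congr_ae
    filter_upwards [hg.coeFn_toLp] with x hx
    rw [hx]; simp [mul_comm]
  obtain ⟨Z, hZ, hZe⟩ := exists_riesz_of_le (bc.gradientGraph hΩ) (hg.toLp g)
    ((eLpNorm g 2 (volume.restrict Ω)).toReal * C) (by
      intro z hz
      replace hz : bc.HasGradient Ω z.1 z.2 := hz
      rw [hl, ← hN.integral_mul_sub_const hg h0 hz.memLp (mean Ω z.1)]
      refine (abs_integral_mul_le hg (hN.memLp_fluct hz.memLp)).trans ?_
      rw [mul_assoc, Lp.norm_def]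
      gcongr
      exact hP _ _ hz.isWeakGradient)
  refine ⟨Z, hZ, fun χ X h => ?_⟩
  have h1 := hZe (h.memLp.toLp χ, h.memLp_grad.toLp X)
    (h.congr h.memLp.coeFn_toLp.symm h.memLp_grad.coeFn_toLp.symm)
  rw [hl] at h1
  rw [← h1]
  apply integral_congr_ae
  filter_upwards [h.memLp.coeFn_toLp] with x hx
  rw [hx]

/-- One direction is Cauchy–Schwarz. For the other, the bound on pairings with gradients extends to
their closure, which contains `Z` itself. -/
theorem Represents.negNorm_eq {hΩ : bc.IsDomain Ω} {g : E d → ℝ}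
    {Z : Lp (E d) 2 (volume.restrict Ω)} (h : bc.Represents hΩ g Z) :
    bc.negNorm Ω g = ENNReal.ofReal ‖Z‖ := by
  apply le_antisymm
  · refine iSup_le fun χ => iSup_le fun X => iSup_le fun hX => ENNReal.div_le_of_le_mul ?_
    rw [h.integral_eq χ X hX, ← ENNReal.ofReal_toReal hX.memLp_grad.2.ne,
      ← ENNReal.ofReal_mul (norm_nonneg _)]
    apply ENNReal.ofReal_le_ofReal
    rw [← Lp.norm_toLp X hX.memLp_grad]
    exact abs_real_inner_le_norm _ _
  · by_cases ht : bc.negNorm Ω g = ⊤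
    · rw [ht]; exact le_top
    rw [ENNReal.ofReal_le_iff_le_toReal ht]
    set s := (bc.negNorm Ω g).toReal with hs
    have hcl : IsClosed {X : Lp (E d) 2 (volume.restrict Ω) | |inner ℝ Z X| ≤ s * ‖X‖} :=
      isClosed_le (by fun_prop) (by fun_prop)
    have hsub : ((bc.gradientSpace hΩ).topologicalClosure : Set _) ⊆
        {X : Lp (E d) 2 (volume.restrict Ω) | |inner ℝ Z X| ≤ s * ‖X‖} := by
      rw [Submodule.topologicalClosure_coe]
      refine closure_minimal ?_ hcl
      intro X hX
      obtain ⟨χ, hχ⟩ := exists_of_mem_gradientSpace hΩ hX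
      rw [Set.mem_ofPred_eq]
      rcases eq_or_ne X 0 with rfl | hX0
      · simp
      have hle : ENNReal.ofReal |∫ x in Ω, g x * χ x| / eLpNorm X 2 (volume.restrict Ω) ≤
          bc.negNorm Ω g :=
        le_iSup_of_le χ (le_iSup_of_le X (le_iSup_of_le hχ le_rfl))
      have hXn : eLpNorm X 2 (volume.restrict Ω) ≠ 0 := by
        intro hh
        apply hX0
        rw [← norm_eq_zero, Lp.norm_def, hh, ENNReal.toReal_zero]
      rw [ENNReal.div_le_iff hXn hχ.memLp_grad.2.ne,
        ENNReal.ofReal_le_iff_le_toReal (ENNReal.mul_ne_top ht hχ.memLp_grad.2.ne),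
        ENNReal.toReal_mul, h.integral_eq χ X hχ, Lp.toLp_coeFn, ← Lp.norm_def] at hle
      exact hle
    have h1 := hsub h.mem
    rw [Set.mem_ofPred_eq, real_inner_self_eq_norm_sq, abs_of_nonneg (by positivity), sq] at h1
    rcases (norm_nonneg Z).eq_or_lt with h0 | h0
    · rw [← h0]; exact ENNReal.toReal_nonneg
    · exact le_of_mul_le_mul_right h1 h0

end BoundaryCondition

/-! ### Lower bound for the nonlinear term -/

section Nonlinearity

variable {f F : ℝ → ℝ} {p c₀ c₁ c₃ : ℝ} {c₂ : ℝ → ℝ}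

theorem Nonlinearity.c₁_nonneg (h : Nonlinearity d f F p c₀ c₁ c₂ c₃) : 0 ≤ c₁ := by
  have h1 := h.coercive 0
  have hp := h.two_le
  rw [abs_zero, Real.zero_rpow (by linarith)] at h1
  linarith

theorem Nonlinearity.c₂_nonneg (h : Nonlinearity d f F p c₀ c₁ c₂ c₃) {η : ℝ} (hη : 0 < η) :
    0 ≤ c₂ η := by
  have h1 := h.growth η hη 0
  have hp := h.two_le
  rw [abs_zero, Real.zero_rpow (by linarith)] at h1
  linarith [abs_nonneg (f 0)]

theorem Nonlinearity.c₃_nonneg (h : Nonlinearity d f F p c₀ c₁ c₂ c₃) : 0 ≤ c₃ := by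
  have h1 := h.lower 0
  have hp := h.two_le
  rw [abs_zero, Real.zero_rpow (by linarith), h.primitive_zero] at h1
  linarith

theorem Nonlinearity.growth_coeff_nonneg (h : Nonlinearity d f F p c₀ c₁ c₂ c₃) {α : ℝ}
    (hα : 0 ≤ α) : 0 ≤ c₂ ((p - 3 / 2) / α) * α := by
  rcases hα.eq_or_lt with rfl | hα
  · simp
  · exact mul_nonneg (h.c₂_nonneg (div_pos (by linarith [h.two_le]) hα)) hα.le

theorem Nonlinearity.C1_nonneg (h : Nonlinearity d f F p c₀ c₁ c₂ c₃) (Ω : Set (E d)) {α : ℝ}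
    (hα : 0 ≤ α) : 0 ≤ C1 Ω p c₁ c₂ c₃ α := by
  have h1 := h.c₁_nonneg
  have h2 := h.growth_coeff_nonneg hα
  have h3 := h.c₃_nonneg
  unfold C1
  positivity

/-- The choice `η = (p - 3/2) / α` lets coercivity absorb the growth of `m * f v` and leaves `(3/2)
c₀ |v|^(2p) ≥ 0`, which is dropped. For `α = 0` the mean is zero and coercivity suffices. -/
theorem Nonlinearity.le_sub_mul (h : Nonlinearity d f F p c₀ c₁ c₂ c₃) {α m : ℝ}
    (hm : |m| ≤ α) (v : ℝ) :
    -(c₁ + c₂ ((p - 3 / 2) / α) * α + 2 * c₃) ≤ (v - m) * f v := by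
  have hα : 0 ≤ α := (abs_nonneg m).trans hm
  have hp := h.two_le
  have hV : 0 ≤ c₀ * |v| ^ (2 * p) := mul_nonneg h.c₀_pos.le (by positivity)
  have hc := h.coercive v
  have hc₃ := h.c₃_nonneg
  rcases hα.eq_or_lt with rfl | hα
  · have : m = 0 := abs_nonpos_iff.1 hm
    subst this
    nlinarith
  · have hη : 0 < (p - 3 / 2) / α := div_pos (by linarith) hα
    have hg := h.growth _ hη v
    have h1 : m * f v ≤ α * |f v| := by
      calc m * f v ≤ |m * f v| := le_abs_self _
        _ = |m| * |f v| := abs_mul _ _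
        _ ≤ α * |f v| := by gcongr
    have h2 : α * |f v| ≤ α * ((p - 3 / 2) / α * c₀ * |v| ^ (2 * p) + c₂ ((p - 3 / 2) / α)) := by
      gcongr
    have h3 : α * ((p - 3 / 2) / α * c₀ * |v| ^ (2 * p) + c₂ ((p - 3 / 2) / α)) =
        (p - 3 / 2) * (c₀ * |v| ^ (2 * p)) + c₂ ((p - 3 / 2) / α) * α := by
      field_simp
    nlinarith

theorem Nonlinearity.neg_C1_le (h : Nonlinearity d f F p c₀ c₁ c₂ c₃) {Ω : Set (E d)}
    (hΩ : IsNiceDomain Ω) {u : E d → ℝ} (hu : MemLp u 2 (volume.restrict Ω))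
    (hfu : MemLp (fun x => f (u x)) 2 (volume.restrict Ω)) {α : ℝ} (hm : |mean Ω u| ≤ α) :
    -C1 Ω p c₁ c₂ c₃ α ≤ ∫ x in Ω, fluct Ω u x * f (u x) := by
  have h1 : ∫ _x in Ω, -(c₁ + c₂ ((p - 3 / 2) / α) * α + 2 * c₃) = -C1 Ω p c₁ c₂ c₃ α := by
    rw [setIntegral_const, C1, smul_eq_mul]; ring
  rw [← h1]
  have hi : Integrable (fun x => fluct Ω u x * f (u x)) (volume.restrict Ω) :=
    (hΩ.memLp_fluct hu).integrable_mul hfu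
  exact integral_mono (hΩ.integrable (hΩ.memLp_const _)) hi fun x => h.le_sub_mul hm (u x)

end Nonlinearity

/-! ### One step of the scheme -/

namespace BoundaryCondition

variable {bc : BoundaryCondition} {Ω : Set (E d)} {v g : E d → ℝ}

theorem IsNegLaplacian.memLp (h : bc.IsNegLaplacian Ω v g) : MemLp v 2 (volume.restrict Ω) := by
  obtain ⟨G, H, hG, -⟩ := h
  exact hG.memLp

theorem IsNegLaplacian.memLp_right (h : bc.IsNegLaplacian Ω v g) :
    MemLp g 2 (volume.restrict Ω) := by
  obtain ⟨G, H, -, hH, hg, -⟩ := h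
  rw [memLp_congr_ae hg]
  exact (memLp_finsetSum _ fun i _ => memLp_coord (hH i).memLp_grad i).neg

theorem IsNegLaplacian.integral_eq_zero (hΩ : bc.IsDomain Ω) (h : bc.IsNegLaplacian Ω v g) :
    ∫ x in Ω, g x = 0 := by
  obtain ⟨G, H, -, -, -, hgreen⟩ := h
  simpa using (hgreen _ _ (hasGradient_const hΩ 1)).symm

/-- One step of the implicit Euler scheme: conservation of mass and the energy estimate. -/
theorem exists_represents_step (hΩ : bc.IsDomain Ω) {γ : ℝ} (hγ : bc.IsGamma Ω γ) {ε : ℝ}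
    (hε : 0 < ε) {f F : ℝ → ℝ} {p c₀ c₁ c₃ α κ : ℝ} {c₂ : ℝ → ℝ}
    (hf : Nonlinearity d f F p c₀ c₁ c₂ c₃) (hκ : 0 < κ) {u u' Au w Aw : E d → ℝ}
    (hu : MemLp u 2 (volume.restrict Ω)) (hm : |mean Ω u| ≤ α)
    (hAu : bc.IsNegLaplacian Ω u' Au)
    (hw : w =ᵐ[volume.restrict Ω] fun x => ε * Au x + f (u' x)) (hAw : bc.IsNegLaplacian Ω w Aw)
    (hstep : ∀ᵐ x ∂(volume.restrict Ω), (u' x - u x) / κ + Aw x = 0)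
    {Z : Lp (E d) 2 (volume.restrict Ω)} (hZ : bc.Represents hΩ (fluct Ω u) Z) :
    mean Ω u' = mean Ω u ∧ ∃ Z', bc.Represents hΩ (fluct Ω u') Z' ∧
      ‖Z'‖ ^ 2 * (γ ^ 2 + ε * κ) ≤ γ ^ 2 * (‖Z‖ ^ 2 + 2 * κ * C1 Ω p c₁ c₂ c₃ α) := by
  have hN := hΩ.isNiceDomain
  have hAw2 := hAw.memLp_right
  have hAu2 := hAu.memLp_right
  have hu' := hAu.memLp
  have hAw0 := hAw.integral_eq_zero hΩ
  have hAu0 := hAu.integral_eq_zero hΩ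
  have hstep' : u' =ᵐ[volume.restrict Ω] fun x => u x - κ * Aw x := by
    filter_upwards [hstep] with x hx
    field_simp at hx
    linarith
  have hmean : mean Ω u' = mean Ω u := by
    unfold mean
    rw [integral_congr_ae hstep', integral_sub (hN.integrable hu)
      ((hN.integrable hAw2).const_mul κ), integral_const_mul, hAw0, mul_zero, sub_zero]
  refine ⟨hmean, ?_⟩
  -- Square integrability of `f(u')` comes from the equation, as the difference of `w` and `ε A u'`.
  have hfu : MemLp (fun x => f (u' x)) 2 (volume.restrict Ω) := by
    refine (memLp_congr_ae ?_).1 (hAw.memLp.sub (hAu2.const_mul ε))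
    filter_upwards [hw] with x hx
    simp [hx]
  obtain ⟨W, -, hW, -, -, hWgreen⟩ := hAw
  obtain ⟨G, -, hG, -, -, hGgreen⟩ := hAu
  have hW2 := hW.memLp_grad
  have hG2 := hG.memLp_grad
  -- This is `∇A⁻¹` applied to the scheme: the Riesz vector of `Aw` is `∇w`, by Green's formula.
  have hrep : bc.Represents hΩ (fluct Ω u') (Z - κ • hW2.toLp W) := by
    refine ⟨Submodule.sub_mem _ hZ.mem (Submodule.smul_mem _ _
      (Submodule.le_topologicalClosure _ (hW.toLp_mem hΩ))), fun χ X hX => ?_⟩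
    have e1 : ∫ x in Ω, fluct Ω u' x * χ x =
        ∫ x in Ω, (fluct Ω u x * χ x - κ * (Aw x * χ x)) := by
      apply integral_congr_ae
      filter_upwards [hstep'] with x hx
      simp only [fluct, hmean, hx]
      ring
    have i1 : Integrable (fun x => fluct Ω u x * χ x) (volume.restrict Ω) :=
      (hN.memLp_fluct hu).integrable_mul hX.memLp
    have i2 : Integrable (fun x => Aw x * χ x) (volume.restrict Ω) :=
      hAw2.integrable_mul hX.memLp
    rw [e1, integral_sub i1 (i2.const_mul κ), integral_const_mul, hZ.integral_eq χ X hX,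
      ← hWgreen χ X hX, inner_sub_left, inner_smul_left, L2.inner_def (hW2.toLp W)]
    congr 2
    apply integral_congr_ae
    filter_upwards [hW2.coeFn_toLp, hX.memLp_grad.coeFn_toLp] with x h1 h2
    rw [h1, h2]
  refine ⟨_, hrep, ?_⟩
  set Z' := Z - κ • hW2.toLp W with hZ'
  have hZeq : Z = Z' + κ • hW2.toLp W := by rw [hZ']; abel
  -- Expanding `‖Z' + κ∇w‖²` and dropping the nonnegative `κ²‖∇w‖²`.
  have hnorm : ‖Z'‖ ^ 2 + 2 * κ * inner ℝ Z' (hW2.toLp W) ≤ ‖Z‖ ^ 2 := by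
    rw [hZeq, norm_add_sq_real, inner_smul_right]
    nlinarith [sq_nonneg ‖κ • hW2.toLp W‖]
  set b := (eLpNorm G 2 (volume.restrict Ω)).toReal with hb
  have hinner : ε * b ^ 2 - C1 Ω p c₁ c₂ c₃ α ≤ inner ℝ Z' (hW2.toLp W) := by
    rw [← hrep.integral_eq w W hW]
    have hfl := hN.memLp_fluct hu'
    have e1 : ∫ x in Ω, fluct Ω u' x * w x =
        ∫ x in Ω, (ε * (Au x * fluct Ω u' x) + fluct Ω u' x * f (u' x)) := by
      apply integral_congr_ae
      filter_upwards [hw] with x hx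
      rw [hx]; ring
    have i1 : Integrable (fun x => Au x * fluct Ω u' x) (volume.restrict Ω) :=
      hAu2.integrable_mul hfl
    have i2 : Integrable (fun x => fluct Ω u' x * f (u' x)) (volume.restrict Ω) :=
      hfl.integrable_mul hfu
    have e2 : ∫ x in Ω, Au x * fluct Ω u' x = b ^ 2 := by
      have e3 := hN.integral_mul_sub_const hAu2 hAu0 hu' (mean Ω u')
      change ∫ x in Ω, Au x * (u' x - mean Ω u') = _
      rw [e3, ← hGgreen u' G hG, hb, ← Lp.norm_toLp G hG2, ← real_inner_self_eq_norm_sq, L2.inner_def]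
      apply integral_congr_ae
      filter_upwards [hG2.coeFn_toLp] with x hx
      rw [hx]
    rw [e1, integral_add (i1.const_mul ε) i2, integral_const_mul, e2]
    have := hf.neg_C1_le hN hu' hfu (hmean ▸ hm)
    linarith
  have hgam : ‖Z'‖ ≤ γ * b := by
    have h1 := hγ.2 u' G hG
    rw [hrep.negNorm_eq, ← ENNReal.ofReal_toReal hG2.2.ne, ← ENNReal.ofReal_mul hγ.1.le] at h1
    exact (ENNReal.ofReal_le_ofReal_iff (mul_nonneg hγ.1.le ENNReal.toReal_nonneg)).1 h1
  have hgam2 : ‖Z'‖ ^ 2 ≤ γ ^ 2 * b ^ 2 := by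
    rw [← mul_pow]
    exact pow_le_pow_left₀ (norm_nonneg _) hgam 2
  have h1 : ‖Z'‖ ^ 2 + 2 * κ * (ε * b ^ 2) ≤ ‖Z‖ ^ 2 + 2 * κ * C1 Ω p c₁ c₂ c₃ α := by
    have := mul_le_mul_of_nonneg_left hinner (by positivity : 0 ≤ 2 * κ)
    linarith
  have h2 := mul_le_mul_of_nonneg_left h1 (sq_nonneg γ)
  have h3 := mul_le_mul_of_nonneg_left hgam2 (by positivity : 0 ≤ ε * κ)
  -- The estimates give the factor `γ² + 2εκ`; one `εκ‖Z'‖²` is discarded.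
  nlinarith [mul_nonneg (by positivity : 0 ≤ ε * κ) (sq_nonneg ‖Z'‖)]

end BoundaryCondition

/-! ### Discrete Gronwall argument -/

/-- One step of the discrete Gronwall inequality. -/
theorem discrete_gronwall_step {a a' γ ε κ k C : ℝ} (hγ : 0 < γ) (hε : 0 < ε) (hκ : 0 < κ)
    (hk : κ ≤ k) (ha : 0 ≤ a) (hC : 0 ≤ C)
    (h : a' * (γ ^ 2 + ε * κ) ≤ γ ^ 2 * (a + 2 * κ * C)) :
    a' ≤ Real.exp (-(ε * κ / (γ ^ 2 + ε * k))) * a +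
      2 * C * ((γ ^ 2 + ε * k) / ε) * (1 - Real.exp (-(ε * κ / (γ ^ 2 + ε * k)))) := by
  have hk0 : 0 < k := hκ.trans_le hk
  set D := γ ^ 2 + ε * k with hD
  set D' := γ ^ 2 + ε * κ with hD'
  have hD0 : 0 < D := by positivity
  have hD0' : 0 < D' := by positivity
  have hDD : D' ≤ D := by rw [hD, hD']; gcongr
  set y := ε * κ / D with hy
  set z := ε * κ / D' with hz
  have hy0 : 0 ≤ y := by positivity
  have hyz : y ≤ z := by rw [hy, hz]; gcongr
  have hlam : γ ^ 2 / D' = 1 - z := by rw [hz, hD']; field_simp; ring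
  have h1 : a' ≤ (1 - z) * a + (1 - z) * (2 * κ * C) := by
    rw [← mul_add, ← hlam, div_mul_eq_mul_div, le_div_iff₀ hD0']
    exact h
  have hexp : 1 - z ≤ Real.exp (-y) := by
    have := Real.add_one_le_exp (-y)
    linarith
  have hexp2 : Real.exp (-y) * (1 + y) ≤ 1 := by
    have := Real.add_one_le_exp y
    calc Real.exp (-y) * (1 + y) ≤ Real.exp (-y) * Real.exp y := by gcongr; linarith
      _ = 1 := by rw [← Real.exp_add]; simp
  have hB : 2 * κ * C = 2 * C * (D / ε) * y := by rw [hy]; field_simp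
  -- After multiplication by `1 + y`, the left side is at most `y` because `(1 - z)(1 + y) ≤ 1 - y²
  -- ≤ 1`, and the right side is at least `y` because `exp(-y)(1 + y) ≤ 1`.
  have h2 : (1 - z) * y ≤ 1 - Real.exp (-y) := by
    have h3 : (1 - z) * (1 + y) ≤ 1 := by nlinarith
    have h4 : y ≤ (1 - Real.exp (-y)) * (1 + y) := by linarith
    have h5 : (1 - z) * (1 + y) * y ≤ (1 - Real.exp (-y)) * (1 + y) := by nlinarith
    have h6 : (1 - z) * y * (1 + y) ≤ (1 - Real.exp (-y)) * (1 + y) := by linarith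
    exact le_of_mul_le_mul_right h6 (by linarith)
  calc a' ≤ (1 - z) * a + (1 - z) * (2 * κ * C) := h1
    _ = (1 - z) * a + 2 * C * (D / ε) * ((1 - z) * y) := by rw [hB]; ring
    _ ≤ _ := by gcongr

theorem IsMesh.step_pos {t : ℕ → ℝ} {k : ℝ} (h : IsMesh t k) (n : ℕ) : 0 < t (n + 1) - t n :=
  sub_pos.2 (h.strictMono n.lt_succ_self)

theorem IsMesh.step_le {t : ℕ → ℝ} {k : ℝ} (h : IsMesh t k) (n : ℕ) : t (n + 1) - t n ≤ k :=
  h.isLUB.1 ⟨n, rfl⟩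

theorem IsMesh.pos {t : ℕ → ℝ} {k : ℝ} (h : IsMesh t k) : 0 < k :=
  (h.step_pos 0).trans_le (h.step_le 0)

namespace BoundaryCondition

variable {bc : BoundaryCondition} {Ω : Set (E d)}

theorem IsEulerSolution.exists_negNorm_eq (hΩ : bc.IsDomain Ω) {γ : ℝ} (hγ : bc.IsGamma Ω γ)
    {ε : ℝ} (hε : 0 < ε) {f F : ℝ → ℝ} {p c₀ c₁ c₃ α k : ℝ} {c₂ : ℝ → ℝ}
    (hf : Nonlinearity d f F p c₀ c₁ c₂ c₃) {t : ℕ → ℝ} (ht : IsMesh t k) {u : ℕ → E d → ℝ}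
    (hu : bc.IsEulerSolution Ω ε f t u) (hm : |mean Ω (u 0)| ≤ α) :
    ∃ a : ℕ → ℝ, (∀ n, 0 ≤ a n) ∧
      (∀ n, bc.negNorm Ω (fluct Ω (u n)) = ENNReal.ofReal (a n)) ∧
      ∀ n, a n ^ 2 ≤ Real.exp (-(ε * t n / (γ ^ 2 + ε * k))) * a 0 ^ 2 +
        2 * C1 Ω p c₁ c₂ c₃ α * ((γ ^ 2 + ε * k) / ε) *
          (1 - Real.exp (-(ε * t n / (γ ^ 2 + ε * k)))) := by
  have hN := hΩ.isNiceDomain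
  have hα : 0 ≤ α := (abs_nonneg _).trans hm
  have hC := hf.C1_nonneg Ω hα
  have hmem : ∀ n, MemLp (u n) 2 (volume.restrict Ω) := by
    rintro (_ | n)
    · exact hu.1
    · obtain ⟨Au, w, Aw, h1, -⟩ := hu.2 n
      exact h1.memLp
  obtain ⟨Z₀, hZ₀⟩ := exists_represents hΩ (hN.memLp_fluct hu.1) (hN.integral_fluct hu.1)
  have key : ∀ n, ∃ Z, bc.Represents hΩ (fluct Ω (u n)) Z ∧ |mean Ω (u n)| ≤ α ∧
      ‖Z‖ ^ 2 ≤ Real.exp (-(ε * t n / (γ ^ 2 + ε * k))) * ‖Z₀‖ ^ 2 +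
        2 * C1 Ω p c₁ c₂ c₃ α * ((γ ^ 2 + ε * k) / ε) *
          (1 - Real.exp (-(ε * t n / (γ ^ 2 + ε * k)))) := by
    intro n
    induction n with
    | zero => exact ⟨Z₀, hZ₀, hm, by simp [ht.zero]⟩
    | succ n ih =>
      obtain ⟨Z, hZ, hmn, hle⟩ := ih
      obtain ⟨Au, w, Aw, hAu, hw, hAw, hstep⟩ := hu.2 n
      obtain ⟨hmean, Z', hZ', hen⟩ := exists_represents_step hΩ hγ hε hf (ht.step_pos n) (hmem n)
        hmn hAu hw hAw hstep hZ
      refine ⟨Z', hZ', by rw [hmean]; exact hmn, ?_⟩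
      refine (discrete_gronwall_step hγ.1 hε (ht.step_pos n) (ht.step_le n) (sq_nonneg _) hC
        hen).trans ?_
      set D := γ ^ 2 + ε * k with hD
      -- The maps `x ↦ e^{-s} x + B (1 - e^{-s})` form a semigroup in `s`, so the one-step bounds
      -- compose without loss.
      have hexp : Real.exp (-(ε * t (n + 1) / D)) =
          Real.exp (-(ε * (t (n + 1) - t n) / D)) * Real.exp (-(ε * t n / D)) := by
        rw [← Real.exp_add]; congr 1; ring
      rw [hexp]
      have := mul_le_mul_of_nonneg_left hle (Real.exp_pos (-(ε * (t (n + 1) - t n) / D))).le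
      linarith
  choose Z hZ _ hZle using key
  -- The chosen `Z 0` need not be syntactically `Z₀`, but both norms equal the dual norm of the
  -- initial fluctuation.
  have h0 : ‖Z 0‖ = ‖Z₀‖ := by
    have := (hZ 0).negNorm_eq.symm.trans hZ₀.negNorm_eq
    exact (ENNReal.ofReal_eq_ofReal_iff (norm_nonneg _) (norm_nonneg _)).1 this
  exact ⟨fun n => ‖Z n‖, fun n => norm_nonneg _, fun n => (hZ n).negNorm_eq, fun n => by
    simp only [h0]; exact hZle n⟩

end BoundaryCondition

end CahnHilliard

end

/-! ### The stability estimate and the absorbing ball -/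

theorem lemma4p2 {d : ℕ} (hd : 1 ≤ d) (hd3 : d ≤ 3)
    (bc : CahnHilliard.BoundaryCondition) (Ω : Set (CahnHilliard.E d)) (hΩ : bc.IsDomain Ω) :
    (∃ γ₁ : ℝ, bc.IsGamma Ω γ₁) ∧
    ∀ γ₁ : ℝ, bc.IsGamma Ω γ₁ →
    ∀ ε : ℝ, 0 < ε →
    ∀ (f F : ℝ → ℝ) (p c₀ c₁ : ℝ) (c₂ : ℝ → ℝ) (c₃ : ℝ),
      CahnHilliard.Nonlinearity d f F p c₀ c₁ c₂ c₃ →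
    ∀ α k : ℝ,
      (∀ t : ℕ → ℝ, CahnHilliard.IsMesh t k →
        ∀ u : ℕ → CahnHilliard.E d → ℝ, bc.IsEulerSolution Ω ε f t u →
          |CahnHilliard.mean Ω (u 0)| ≤ α →
          bc.negNorm Ω (CahnHilliard.fluct Ω (u 0)) ≠ ⊤ ∧
          ∀ n : ℕ,
            bc.negNorm Ω (CahnHilliard.fluct Ω (u (n + 1))) ^ 2 ≤
              ENNReal.ofReal (Real.exp (-(ε * t (n + 1) / (γ₁ ^ 2 + ε * k)))) *
                  bc.negNorm Ω (CahnHilliard.fluct Ω (u 0)) ^ 2 +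
                ENNReal.ofReal (2 * CahnHilliard.C1 Ω p c₁ c₂ c₃ α * ((γ₁ ^ 2 + ε * k) / ε) *
                  (1 - Real.exp (-(ε * t (n + 1) / (γ₁ ^ 2 + ε * k)))))) ∧
      (∀ R ρ : ℝ,
        Real.sqrt (2 * CahnHilliard.C1 Ω p c₁ c₂ c₃ α * ((γ₁ ^ 2 + ε * k) / ε)) < ρ →
        ∃ T : ℝ, ∀ t : ℕ → ℝ, CahnHilliard.IsMesh t k →
          ∃ n₀ : ℕ, 0 < n₀ ∧ (∀ i : ℕ, 0 < i → T ≤ t i → n₀ ≤ i) ∧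
            ∀ u : ℕ → CahnHilliard.E d → ℝ, bc.IsEulerSolution Ω ε f t u →
              |CahnHilliard.mean Ω (u 0)| ≤ α →
              bc.negNorm Ω (CahnHilliard.fluct Ω (u 0)) ≤ ENNReal.ofReal R →
              ∀ n : ℕ, n₀ ≤ n →
                bc.negNorm Ω (CahnHilliard.fluct Ω (u n)) ≤ ENNReal.ofReal ρ) := by
  refine ⟨bc.exists_isGamma hΩ.isNiceDomain, ?_⟩
  intro γ₁ hγ ε hε f F p c₀ c₁ c₂ c₃ hf α k
  set D := γ₁ ^ 2 + ε * k with hD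
  set B := 2 * CahnHilliard.C1 Ω p c₁ c₂ c₃ α * (D / ε) with hB
  refine ⟨?_, ?_⟩
  · intro t ht u hu hm
    obtain ⟨a, ha0, ha, hle⟩ := hu.exists_negNorm_eq hΩ hγ hε hf ht hm
    refine ⟨by rw [ha]; exact ENNReal.ofReal_ne_top, fun n => ?_⟩
    rw [ha, ha, ← ENNReal.ofReal_pow (ha0 _), ← ENNReal.ofReal_pow (ha0 _),
      ← ENNReal.ofReal_mul (Real.exp_pos _).le]
    exact (ENNReal.ofReal_le_ofReal (hle (n + 1))).trans ENNReal.ofReal_add_le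
  · intro R ρ hρ
    by_cases hk : 0 < k
    swap
    · exact ⟨0, fun t ht => absurd ht.pos hk⟩
    have hD0 : 0 < D := by have := hγ.1; positivity
    have hρ0 : 0 < ρ := (Real.sqrt_nonneg _).trans_lt hρ
    have hBρ : B < ρ ^ 2 := (Real.sqrt_lt' hρ0).1 hρ
    -- The time `T` depends only on this majorant, hence neither on the mesh nor on the solution.
    have hlim : Filter.Tendsto (fun s : ℝ => Real.exp (-(ε * s / D)) * R ^ 2 + B) Filter.atTop
        (nhds (0 * R ^ 2 + B)) := by
      refine Filter.Tendsto.add_const _ (Filter.Tendsto.mul_const _ ?_)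
      refine Real.tendsto_exp_neg_atTop_nhds_zero.comp ?_
      exact (Filter.tendsto_id.const_mul_atTop hε).atTop_div_const hD0
    obtain ⟨T, hT⟩ := Filter.eventually_atTop.1
      (hlim.eventually_lt_const (by simpa using hBρ : 0 * R ^ 2 + B < ρ ^ 2))
    refine ⟨T, fun t ht => ?_⟩
    have hex : ∃ i, 0 < i ∧ T ≤ t i :=
      ((Filter.eventually_gt_atTop 0).and (ht.tendsto.eventually_ge_atTop T)).exists
    classical
    refine ⟨Nat.find hex, (Nat.find_spec hex).1, fun i hi hTi => Nat.find_min' hex ⟨hi, hTi⟩, ?_⟩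
    intro u hu hm hR n hn
    have hTn : T ≤ t n := (Nat.find_spec hex).2.trans (ht.strictMono.monotone hn)
    obtain ⟨a, ha0, ha, hle⟩ := hu.exists_negNorm_eq hΩ hγ hε hf ht hm
    rw [ha] at hR ⊢
    apply ENNReal.ofReal_le_ofReal
    have hα : 0 ≤ α := (abs_nonneg _).trans hm
    have hB0 : 0 ≤ B := by have := hf.C1_nonneg Ω hα; positivity
    have haR : a 0 ^ 2 ≤ R ^ 2 := by
      rcases le_or_gt 0 R with hR0 | hR0
      · exact pow_le_pow_left₀ (ha0 0) ((ENNReal.ofReal_le_ofReal_iff hR0).1 hR) 2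
      -- A negative `R` is truncated to zero by `ENNReal.ofReal`, which forces `a 0 = 0`.
      · rw [ENNReal.ofReal_of_nonpos hR0.le, nonpos_iff_eq_zero, ENNReal.ofReal_eq_zero] at hR
        rw [le_antisymm hR (ha0 0)]
        simpa using sq_nonneg R
    have h1 : a n ^ 2 ≤ Real.exp (-(ε * t n / D)) * a 0 ^ 2 +
        B * (1 - Real.exp (-(ε * t n / D))) := hle n
    have h2 := hT (t n) hTn
    have h3 := mul_le_mul_of_nonneg_left haR (Real.exp_pos (-(ε * t n / D))).le
    have h4 := mul_nonneg hB0 (Real.exp_pos (-(ε * t n / D))).le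
    exact le_of_lt (lt_of_pow_lt_pow_left₀ 2 hρ0.le (by linarith))
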